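/- Let $r\in\{4,\dots,8\}$. Let $\mathbf{Pic}(X_r)=\mathbf Z h\oplus\bigoplus_{i=1}^r\mathbf Z\ell_i$ be the Picard lattice of the blow-up $X_r$ of the complex projective plane in $r$ points in general position, where $h$ is the class of the pull-back of a general line and $\ell_i$ is the class of the $i$-th exceptional divisor. Its intersection pairing is given by $h^2=1$, $\ell_i^2=-1$, $(h,\ell_i)=0$, and $(\ell_i,\ell_j)=0$ for $i\neq j$; its canonical class is $K_r=-3h+\sum_{i=1}^r\ell_i$. Let $W(E_r)$ be the Weyl group generated by the reflections $s_i:d\mapsto d+(d,\rho_i)\,\rho_i$ of $\mathbf{Pic}(X_r)$ in the simple roots $\rho_i=\ell_i-\ell_{i+1}$ for $1\le i\le r-1$, and $\rho_r=h-\ell_1-\ell_2-\ell_3$ (thus $E_4=A_4$ and $E_5=D_5$). This group preserves the pairing and fixes $K_r$, hence permutes the set of lines $$\mathcal L_r=\{\,l\in\mathbf{Pic}(X_r)\;:\;(K_r,l)=(l,l)=-1\,\},$$ so that the space $\mathbf C^{\mathcal L_r}$ freely spanned by $\mathcal L_r$ is a permutation representation of $W(E_r)$. Let $\mathbf{sign}$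 be the one-dimensional signature representation of $W(E_r)$, in which $w$ acts as multiplication by $\det(w)\in\{\pm1\}$ (so each $s_i$ acts as $-1$). Let $m_r$ be the multiplicity of $\mathbf{sign}$ in $\wedge^{r-2}\mathbf C^{\mathcal L_r}$, that is, the number of summands isomorphic to $\mathbf{sign}$ in any decomposition of $\wedge^{r-2}\mathbf C^{\mathcal L_r}$ as a direct sum of irreducible $W(E_r)$-modules. Then $$m_r=\begin{cases}0 & \text{for } r=4,5,6,7,\\ 5 & \text{for } r=8.\end{cases}$$ -/

import Mathlib

/-! ## The Picard lattice of a blow-up of the plane in `r` points -/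

/-- The Picard lattice `Pic(X_r) = ℤ h ⊕ ℤ ℓ₁ ⊕ ⋯ ⊕ ℤ ℓ_r` of the blow-up `X_r` of the projective
plane in `r` points in general position; `(a, b)` stands for `a h + ∑ bᵢ ℓᵢ`. -/
abbrev Pic (r : ℕ) : Type := ℤ × (Fin r → ℤ)

namespace Pic

/-- The class `h` of the pull-back of a general line of the plane. -/
def h (r : ℕ) : Pic r := (1, 0)

/-- The class `ℓᵢ` of the `i`-th exceptional divisor (indices start at `0`). -/
def l {r : ℕ} (i : Fin r) : Pic r := (0, Pi.single i 1)

/-- The intersection pairing: `h² = 1`, `ℓᵢ² = -1`, and distinct basis elements are orthogonal. -/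
def pairing (r : ℕ) : LinearMap.BilinForm ℤ (Pic r) :=
  LinearMap.mk₂ ℤ (fun x y => x.1 * y.1 - ∑ i, x.2 i * y.2 i)
    (by intro x x' y; simp [add_mul, Finset.sum_add_distrib]; ring)
    (by intro c x y; simp [mul_assoc, Finset.mul_sum, mul_sub])
    (by intro x y y'; simp [mul_add, Finset.sum_add_distrib]; ring)
    (by intro c x y; simp [mul_left_comm, Finset.mul_sum, mul_sub])

theorem pairing_apply {r : ℕ} (x y : Pic r) :
    pairing r x y = x.1 * y.1 - ∑ i, x.2 i * y.2 i := rfl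

theorem pairing_comm {r : ℕ} (x y : Pic r) : pairing r x y = pairing r y x := by
  simp [pairing_apply, mul_comm]

/-- The canonical class `K = -3 h + ∑ ℓᵢ`. -/
def K (r : ℕ) : Pic r := (-3 : ℤ) • h r + ∑ i : Fin r, l i

/-! ## Roots, reflections and the Weyl group -/

/-- The roots: the classes `ρ` with `(ρ, K) = 0` and `ρ² = -2`. -/
abbrev Root (r : ℕ) : Type := {ρ : Pic r // pairing r ρ (K r) = 0 ∧ pairing r ρ ρ = -2}

/-- The reflection `s_ρ : d ↦ d + (d, ρ) ρ` attached to a root `ρ`. -/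
def reflection {r : ℕ} (ρ : Root r) : Pic r ≃ₗ[ℤ] Pic r :=
  Module.reflection (x := ρ.1) (f := -(pairing r ρ.1)) (by simp [ρ.2.2])

theorem reflection_apply {r : ℕ} (ρ : Root r) (d : Pic r) :
    reflection ρ d = d + pairing r d ρ.1 • ρ.1 := by
  simp [reflection, Module.reflection_apply, pairing_comm d ρ.1]

/-- The simple roots: with indices starting at `1`, they are `ρᵢ = ℓᵢ - ℓᵢ₊₁` for
`i = 1, …, r - 1` and `ρ_r = h - ℓ₁ - ℓ₂ - ℓ₃`. (In the code the indices start at `0`.) -/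
def simpleRoot (r : ℕ) (i : Fin r) : Pic r :=
  if hi : i.1 + 1 < r then l i - l ⟨i.1 + 1, hi⟩ else h r - ∑ j : Fin r with j.1 < 3, l j

/-- The Weyl group `W(E_r)`, generated by the reflections in the simple roots. -/
def weylGroup (r : ℕ) : Subgroup (Pic r ≃ₗ[ℤ] Pic r) :=
  Subgroup.closure (reflection '' {ρ : Root r | ∃ i, ρ.1 = simpleRoot r i})

/-- The signature `W(E_r) → {±1}`, i.e. the determinant; it sends every reflection to `-1`
(see `sign_reflection`). -/
noncomputable def sign (r : ℕ) : weylGroup r →* ℤˣ :=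
  LinearEquiv.det.comp (weylGroup r).subtype

theorem sign_reflection {r : ℕ} (ρ : Root r) (hρ : reflection ρ ∈ weylGroup r) :
    sign r ⟨reflection ρ, hρ⟩ = -1 := by
  have e : ((reflection ρ : Pic r ≃ₗ[ℤ] Pic r) : Pic r →ₗ[ℤ] Pic r) =
      LinearMap.transvection (pairing r ρ.1) ρ.1 := by
    refine LinearMap.ext fun d => ?_
    simp [reflection_apply, LinearMap.transvection.apply, pairing_comm d ρ.1]
  ext
  simp [sign, LinearEquiv.coe_det, e, LinearMap.transvection.det, ρ.2.2]

/-- The simple roots are roots as soon as `r ≥ 3`. -/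
theorem simpleRoot_isRoot {r : ℕ} (hr : 3 ≤ r) (i : Fin r) :
    pairing r (simpleRoot r i) (K r) = 0 ∧ pairing r (simpleRoot r i) (simpleRoot r i) = -2 := by
  obtain ⟨n, rfl⟩ := Nat.exists_eq_add_of_le' hr
  have hK : ∀ j, (K (n + 3)).2 j = 1 := by
    intro j; simp [K, h, l, Prod.snd_sum, Finset.sum_apply, Pi.single_apply]
  have hK1 : (K (n + 3)).1 = -3 := by simp [K, h, l, Prod.fst_sum]
  unfold simpleRoot
  split_ifs with hi
  · have hne : i ≠ ⟨i.1 + 1, hi⟩ := by simp [Fin.ext_iff]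
    simp [pairing_apply, hK, hK1, l, mul_sub, Finset.sum_sub_distrib, Pi.single_apply,
      hne, hne.symm]
  · have h2 : ∀ j : Fin (n + 3),
        (h (n + 3) - ∑ k : Fin (n + 3) with k.1 < 3, l k).2 j = if j.1 < 3 then -1 else 0 := by
      intro j
      simp only [h, l, Prod.snd_sub, Prod.snd_sum, Pi.sub_apply, Finset.sum_apply,
        Pi.single_apply]
      simp [Finset.sum_ite_eq]
      split_ifs <;> simp
    have h1 : (h (n + 3) - ∑ k : Fin (n + 3) with k.1 < 3, l k).1 = 1 := by
      simp [h, l, Prod.fst_sum]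
    simp only [pairing_apply, h2, h1, hK, hK1]
    have h3 : ∀ m : ℕ, ¬ (m + 1 + 1 + 1 < 3) := by omega
    simp [Fin.sum_univ_succ, h3]

/-! ## Lines and the permutation representation -/

theorem weylGroup_preserves {r : ℕ} {w : Pic r ≃ₗ[ℤ] Pic r} (hw : w ∈ weylGroup r) :
    w (K r) = K r ∧ ∀ x y, pairing r (w x) (w y) = pairing r x y := by
  induction hw using Subgroup.closure_induction with
  | mem w hw =>
    obtain ⟨ρ, -, rfl⟩ := hw
    refine ⟨by simp [reflection_apply, pairing_comm (K r), ρ.2.1], fun x y => ?_⟩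
    simp only [reflection_apply, map_add, LinearMap.add_apply, map_smul, LinearMap.smul_apply,
      smul_eq_mul, ρ.2.2, pairing_comm ρ.1 y]
    ring
  | one => simp
  | mul v w _ _ hv hw => simp [hv.1, hw.1, hv.2, hw.2]
  | inv w _ hw =>
    have hi : ∀ x, w (w⁻¹ x) = x := fun x => w.apply_symm_apply x
    refine ⟨w.injective ((hi _).trans hw.1.symm), fun x y => ?_⟩
    rw [← hw.2, hi, hi]

/-- The set `𝓛_r` of lines: the classes `c` with `(K, c) = (c, c) = -1`. -/
abbrev Line (r : ℕ) : Type := {c : Pic r // pairing r (K r) c = -1 ∧ pairing r c c = -1}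

/-- The Weyl group permutes the lines. -/
instance (r : ℕ) : MulAction (weylGroup r) (Line r) where
  smul w x := ⟨w.1 x.1, by
    have hw := weylGroup_preserves w.2
    have hK := hw.2 (K r) x.1
    rw [hw.1] at hK
    exact ⟨hK.trans x.2.1, (hw.2 _ _).trans x.2.2⟩⟩
  one_smul _ := rfl
  mul_smul _ _ _ := rfl

theorem coe_smul_line {r : ℕ} (w : weylGroup r) (x : Line r) :
    ((w • x : Line r) : Pic r) = w.1 x.1 := rfl

end Pic

/-! ## Exterior powers and multiplicities -/

namespace Representation

variable {k G V U : Type*} [Field k] [Group G] [AddCommGroup V] [Module k V]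
  [AddCommGroup U] [Module k U]

/-- The `n`-th exterior power of a representation: `g (v₁ ∧ ⋯ ∧ vₙ) = g v₁ ∧ ⋯ ∧ g vₙ`. -/
noncomputable def exteriorPow (n : ℕ) (ρ : Representation k G V) :
    Representation k G (⋀[k]^n V) where
  toFun g := exteriorPower.map n (ρ g)
  map_one' := by rw [map_one]; exact exteriorPower.map_id
  map_mul' g g' := by rw [map_mul]; exact exteriorPower.map_comp (ρ g') (ρ g)

/-- The subrepresentations `S i` are irreducible and `V` is their internal direct sum. -/
def IsIrreducibleDecomposition {ρ : Representation k G V} {n : ℕ}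
    (S : Fin n → Subrepresentation ρ) : Prop :=
  DirectSum.IsInternal (fun i => (S i).toSubmodule) ∧ ∀ i, (S i).toRepresentation.IsIrreducible

/-- The irreducible representation `σ` has multiplicity `m` in `ρ`: the representation `ρ`
decomposes into finitely many irreducible subrepresentations, and in each such decomposition
exactly `m` of the summands are isomorphic to `σ`. -/
def HasMultiplicity (ρ : Representation k G V) (σ : Representation k G U) (m : ℕ) : Prop :=
  (∃ (n : ℕ) (S : Fin n → Subrepresentation ρ), IsIrreducibleDecomposition S) ∧
  ∀ (n : ℕ) (S : Fin n → Subrepresentation ρ), IsIrreducibleDecomposition S →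
    Nat.card {i : Fin n // Nonempty ((S i).toRepresentation.Equiv σ)} = m

end Representation

namespace Pic

/-- The permutation representation of `W(E_r)` on the space `ℂ^{𝓛_r}` freely spanned by the
lines. -/
noncomputable abbrev lineRep (r : ℕ) :
    Representation ℂ (weylGroup r) (MonoidAlgebra ℂ (Line r)) :=
  Representation.ofMulAction ℂ (weylGroup r) (Line r)

/-- The signature representation of `W(E_r)`: the group acts on `ℂ` through `sign`. -/
noncomputable def signRep (r : ℕ) : Representation ℂ (weylGroup r) ℂ where
  toFun w := (((sign r w : ℤˣ) : ℤ) : ℂ) • LinearMap.id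
  map_one' := by ext; simp
  map_mul' v w := by ext; simp [mul_comm]

end Pic

/-!
The multiplicity of `sign` in `⋀ᵏ ℂ^{𝓛_r}`, `k = r - 2`, is the dimension of the space of vectors
on which the Weyl group `W` acts through the signature
(`Representation.hasMultiplicity_of_finrank_eigenspace`), and this space is spanned by the vectors
`F t = ∑ w, sign w • w (t₁ ∧ ⋯ ∧ t_k)`, where `t` runs over the lists of `k` lines
(`Representation.twistedSum`, `Representation.eigenspace_exteriorPow_ofMulAction`). Up to sign,
`F t` is unchanged if `t` is rearranged or moved by `W`, and `F t = 0` if some reflection in `W`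
fixes all members of `t`, that is, if a root is orthogonal to all of them. More generally `F t = 0`
if some `w` permutes the members of `t` by a permutation whose sign is not `sign w`. So the problem
is to enumerate, up to `W`, the sets of `r - 2` lines without an orthogonal root.

This is done by an exhaustive search (`Pic.Code.Table.search`). The members of `t` are chosen one
at a time. When `p` has been chosen, the next line `x` may be moved by the pointwise stabilizer of
`p` in `W`, so that it may be taken of smallest height in its orbit; then `(x, ρ) ≥ 0` for all
positive roots `ρ` orthogonal to `p` (`Pic.exists_dominant`), and for the last line all these
pairings have to be positive. As the order of the choices is immaterial, the lines are moreover
sorted into an ordered list of blocks according to their pairings with `p`, and the next line is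
taken from the first block that meets the rest of `t`. The search is proved exhaustive in
`Pic.Code.Table.Valid.of_search`.

For `r ≤ 7` nothing survives the search, and the multiplicity is `0`. For `r = 8` there are `435`
survivors. A certificate shows for each of them either that `F t = 0`, by a `w` acting on `t` with
the wrong sign, or that `t` is equivalent to one of five representatives (`Pic.Code.certificates`,
`Pic.Code.of_certify`). Hence the `F t` of the five representatives span the eigenspace. They are
linearly independent (`Representation.linearIndependent_twistedSum`): no group element maps one
representative to another one, as there is not even a bijection preserving the pairings, and an
element that permutes a representative does so with sign `sign w`. For the latter, each
pairing-preserving permutation is realized by an explicit word in reflections with the right sign,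
and this is the only realization, since a group element fixing a representative pointwise fixes all
`ℓᵢ` (`Pic.Code.isolated_l`) and is therefore the identity (`Pic.eq_of_forall_apply_l`).

The finite verifications are evaluated by the kernel.
-/

/-! ### Multiplicities of one-dimensional representations -/

namespace Representation

variable {k G V : Type*} [Field k] [Group G] [AddCommGroup V] [Module k V]

/-- The space of vectors on which `G` acts through the character `χ`. -/
def eigenspace (ρ : Representation k G V) (χ : G → k) : Submodule k V where
  carrier := {v | ∀ g, ρ g v = χ g • v}
  zero_mem' g := by simp
  add_mem' hv hw g := by rw [map_add, hv g, hw g, smul_add]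
  smul_mem' c v hv g := by rw [map_smul, hv g, smul_comm]

theorem mem_eigenspace {ρ : Representation k G V} {χ : G → k} {v : V} :
    v ∈ eigenspace ρ χ ↔ ∀ g, ρ g v = χ g • v := Iff.rfl

/-- An atom of the lattice of subrepresentations is irreducible. -/
theorem isIrreducible_of_isAtom {ρ : Representation k G V} {S : Subrepresentation ρ}
    (hS : IsAtom S) : S.toRepresentation.IsIrreducible := by
  let up (T : Subrepresentation S.toRepresentation) : Subrepresentation ρ :=
    ⟨T.toSubmodule.map S.toSubmodule.subtype, by
      intro g w hw
      obtain ⟨v, hv, rfl⟩ := hw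
      exact ⟨S.toRepresentation g v, T.apply_mem_toSubmodule g hv, rfl⟩⟩
  have hup (T) : up T ≤ S := by
    intro w hw
    obtain ⟨v, -, h⟩ := hw
    exact h ▸ v.2
  have hnt : Nontrivial (Subrepresentation S.toRepresentation) := by
    refine ⟨⊥, ⊤, fun h => hS.1 ?_⟩
    refine le_antisymm (fun v hv => ?_) bot_le
    have : (⟨v, hv⟩ : S.toSubmodule) ∈ (⊤ : Subrepresentation S.toRepresentation) :=
      Submodule.mem_top (R := k)
    rw [← h] at this
    exact congrArg Subtype.val ((Submodule.mem_bot k).1 this)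
  refine { hnt with eq_bot_or_eq_top := fun T => ?_ }
  obtain h | h : up T = ⊥ ∨ up T = S := hS.le_iff.1 (hup T)
  · left
    refine le_antisymm (fun v hv => ?_) bot_le
    have : (v : V) ∈ up T := ⟨v, hv, rfl⟩
    rw [h] at this
    exact (Submodule.mem_bot k).2 (Subtype.ext ((Submodule.mem_bot k).1 this))
  · right
    refine le_antisymm le_top fun v _ => ?_
    have hv : (v : V) ∈ S := v.2
    obtain ⟨w, hw, e⟩ := (h.symm.le : S ≤ up T) hv
    exact Subtype.ext e ▸ hw

/-- Maschke's theorem, phrased with subrepresentations. -/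
theorem exists_isIrreducibleDecomposition [Finite G] [CharZero k] [FiniteDimensional k V]
    (ρ : Representation k G V) :
    ∃ (n : ℕ) (S : Fin n → Subrepresentation ρ), IsIrreducibleDecomposition S := by
  have hG : NeZero (Nat.card G : k) := ⟨Nat.cast_ne_zero.2 Nat.card_pos.ne'⟩
  have : Module.Finite (MonoidAlgebra k G) ρ.asModule := by
    have : Module.Finite k ρ.asModule := inferInstanceAs (Module.Finite k V)
    exact Module.Finite.of_restrictScalars_finite k _ _
  obtain ⟨s, hs, hs', hsimple⟩ :=
    IsSemisimpleModule.exists_sSupIndep_sSup_simples_eq_top (MonoidAlgebra k G) ρ.asModule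
  have hfin : s.Finite := WellFoundedGT.finite_of_sSupIndep hs
  have : Finite s := hfin
  obtain ⟨n, ⟨e⟩⟩ := Finite.exists_equiv_fin s
  let A : Fin n → Submodule (MonoidAlgebra k G) ρ.asModule := fun i => (e.symm i).1
  have hA : DirectSum.IsInternal A := by
    rw [DirectSum.isInternal_submodule_iff_iSupIndep_and_iSup_eq_top]
    constructor
    · have := (sSupIndep_iff s).1 hs
      exact this.comp e.symm.injective
    · rw [← hs', sSup_eq_iSup', ← e.symm.iSup_comp]
  refine ⟨n, fun i => Subrepresentation.ofSubmodule' (A i), hA, fun i => ?_⟩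
  have : IsAtom (A i) := isSimpleModule_iff_isAtom.1 (hsimple _ (e.symm i).2)
  exact isIrreducible_of_isAtom
    ((OrderIso.isAtom_iff Subrepresentation.subrepresentationSubmoduleOrderIso.symm _).2 this)

/-- The multiplicity of a one-dimensional representation is the dimension of its eigenspace. -/
theorem hasMultiplicity_of_finrank_eigenspace [Finite G] [CharZero k] [FiniteDimensional k V]
    (ρ : Representation k G V) (σ : Representation k G k) (χ : G → k)
    (hσ : ∀ g x, σ g x = χ g * x) {m : ℕ} (hm : Module.finrank k (eigenspace ρ χ) = m) :
    ρ.HasMultiplicity σ m := by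
  classical
  refine ⟨exists_isIrreducibleDecomposition ρ, fun n S ⟨hS, hirr⟩ => ?_⟩
  -- the decomposition as a linear equivalence
  let e : (∀ i, (S i).toSubmodule) ≃ₗ[k] V :=
    (DirectSum.linearEquivFunOnFintype k (Fin n) fun i => (S i).toSubmodule).symm.trans
      (LinearEquiv.ofBijective (DirectSum.coeLinearMap fun i => (S i).toSubmodule) hS)
  have he (x) : e x = ∑ i, (x i : V) := by
    have : x = ∑ i, Pi.single i (x i) := (Finset.univ_sum_single x).symm
    conv_lhs => rw [this]
    rw [map_sum]
    refine Finset.sum_congr rfl fun i _ => ?_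
    change DirectSum.coeLinearMap _ ((DirectSum.linearEquivFunOnFintype k (Fin n) fun i =>
      (S i).toSubmodule).symm (Pi.single i (x i))) = _
    rw [DirectSum.linearEquivFunOnFintype_symm_single, DirectSum.coeLinearMap_lof]
  have hρ (g : G) (x) : e (fun i => (S i).toRepresentation g (x i)) = ρ g (e x) := by
    simp only [he, map_sum]
    rfl
  -- the eigenspace is the sum of the eigenspaces of the summands
  let E (i : Fin n) := eigenspace (S i).toRepresentation χ
  have hE : Module.finrank k (eigenspace ρ χ) = ∑ i, Module.finrank k (E i) := by
    rw [← Module.finrank_pi_fintype]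
    have hmem (x) : e x ∈ eigenspace ρ χ ↔ ∀ i, x i ∈ E i := by
      simp only [mem_eigenspace, E]
      rw [forall_comm]
      refine forall_congr' fun g => ?_
      rw [← hρ, ← map_smul, e.injective.eq_iff, funext_iff]
      rfl
    let f := LinearMap.codRestrict (eigenspace ρ χ)
      (e.toLinearMap ∘ₗ LinearMap.pi fun i => (E i).subtype ∘ₗ LinearMap.proj i)
      fun x => (hmem _).2 fun i => (x i).2
    have hf : Function.Bijective f := by
      refine ⟨fun x y h => ?_, fun y => ?_⟩
      · have h' : e (fun i => (x i : (S i).toSubmodule)) = e (fun i => y i) :=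
          congrArg (fun z : eigenspace ρ χ => (z : V)) h
        have := e.injective h'
        funext i
        exact Subtype.ext (congrFun this i)
      · have hy := y.2
        rw [← e.apply_symm_apply y.1, hmem] at hy
        exact ⟨fun i => ⟨_, hy i⟩, Subtype.ext (e.apply_symm_apply y.1)⟩
    exact (LinearEquiv.ofBijective f hf).finrank_eq.symm
  have hE1 (i) : Module.finrank k (E i) =
      if Nonempty ((S i).toRepresentation.Equiv σ) then 1 else 0 := by
    have := hirr i
    split_ifs with h
    · obtain ⟨φ⟩ := h
      have : E i = ⊤ := by
        refine eq_top_iff.2 fun v _ g => ?_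
        apply φ.toLinearEquiv.injective
        have : φ.toLinearEquiv ((S i).toRepresentation g v) = σ g (φ.toLinearEquiv v) :=
          IntertwiningMap.isIntertwining _ _ φ.toIntertwiningMap g v
        rw [this, hσ, map_smul, smul_eq_mul]
      rw [this, finrank_top, φ.toLinearEquiv.finrank_eq, Module.finrank_self]
    · refine (Submodule.finrank_eq_zero (S := E i)).2 ((Submodule.eq_bot_iff _).2 fun v hv => ?_)
      by_contra hv0
      -- a nonzero eigenvector spans the whole summand
      let T : Subrepresentation (S i).toRepresentation := ⟨k ∙ v, fun g w hw => by
        obtain ⟨c, rfl⟩ := Submodule.mem_span_singleton.1 hw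
        rw [map_smul, hv g]
        exact Submodule.smul_mem _ _ (Submodule.smul_mem _ _ (Submodule.mem_span_singleton_self v))⟩
      have hT : T = ⊤ := (eq_bot_or_eq_top T).resolve_left fun h => hv0 <| by
        have : v ∈ T := Submodule.mem_span_singleton_self v
        rw [h] at this
        exact (Submodule.mem_bot k).1 this
      refine h ⟨(Equiv.mk (LinearEquiv.ofBijective (LinearMap.toSpanSingleton k _ v)
        ⟨smul_left_injective k hv0, fun w => ?_⟩) fun g => ?_ : σ.Equiv _).symm⟩
      · have : w ∈ T := hT ▸ Submodule.mem_top (R := k)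
        exact Submodule.mem_span_singleton.1 this
      · refine LinearMap.ext fun c => ?_
        change σ g c • v = (S i).toRepresentation g (c • v)
        rw [map_smul, hv g, hσ, smul_smul, mul_comm]
  rw [← hm, hE, Finset.sum_congr rfl fun i _ => hE1 i, Nat.card_eq_fintype_card,
    Fintype.card_subtype, Finset.card_filter]

end Representation

/-! ### Signs of rearrangements -/

/-- If `l'` is a rearrangement of `l`, a sign relating the two (the sign of one permutation that
carries `l'` to `l`); otherwise `0`. -/
def List.permSign {α : Type*} [DecidableEq α] : List α → List α → ℤ
  | [], l' => if l' = [] then 1 else 0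
  | a :: l, l' => if a ∈ l' then (-1) ^ l'.idxOf a * permSign l (l'.erase a) else 0

namespace List

variable {α β M : Type*}

/-- A function of lists that changes sign when two neighbouring entries are exchanged. -/
def SwapNeg [Neg M] (F : List α → M) : Prop :=
  ∀ p a b q, F (p ++ a :: b :: q) = -F (p ++ b :: a :: q)

theorem SwapNeg.append [Neg M] {F : List α → M} (hF : SwapNeg F) (p : List α) :
    SwapNeg fun l => F (p ++ l) := fun q a b s => by
  simpa using hF (p ++ q) a b s

/-- Moving a member of a list to the front. -/
theorem SwapNeg.cons_erase [AddCommGroup M] [DecidableEq α] {F : List α → M} (hF : SwapNeg F)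
    {a : α} {l : List α} (ha : a ∈ l) (p : List α) :
    F (p ++ a :: l.erase a) = (-1 : ℤ) ^ l.idxOf a • F (p ++ l) := by
  induction l generalizing p with
  | nil => simp at ha
  | cons b l ih =>
    by_cases h : b = a
    · subst h; simp
    · have ha' : a ∈ l := (mem_cons.1 ha).resolve_left (Ne.symm h)
      rw [erase_cons_tail (by simpa using h), idxOf_cons_ne _ h, hF, pow_succ]
      have := ih ha' (p ++ [b])
      simp only [append_assoc, cons_append, nil_append] at this
      rw [this]; simp

theorem SwapNeg.eq_permSign_smul [AddCommGroup M] [DecidableEq α] {F : List α → M}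
    (hF : SwapNeg F) {l l' : List α} (h : permSign l l' ≠ 0) :
    F l = permSign l l' • F l' := by
  induction l generalizing l' F with
  | nil =>
    rw [permSign] at h ⊢
    split_ifs at h ⊢ with h'
    · simp [h']
    · simp at h
  | cons a l ih =>
    rw [permSign] at h ⊢
    split_ifs at h ⊢ with h'
    · have h1 := right_ne_zero_of_mul h
      have h2 := ih (hF.append [a]) h1
      have h3 := hF.cons_erase h' []
      simp only [nil_append, cons_append] at h2 h3
      rw [h2, h3, smul_smul, mul_comm]
    · simp at h

theorem SwapNeg.perm [AddCommGroup M] {F : List α → M} (hF : SwapNeg F) {l l' : List α}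
    (h : l ~ l') : F l = F l' ∨ F l = -F l' := by
  suffices H : ∀ p, F (p ++ l) = F (p ++ l') ∨ F (p ++ l) = -F (p ++ l') from H []
  induction h with
  | nil => simp
  | cons a _ ih => intro p; simpa using ih (p ++ [a])
  | swap a b l => intro p; exact Or.inr (hF p b a l)
  | trans _ _ ih ih' =>
    intro p
    rcases ih p with h | h <;> rcases ih' p with h' | h' <;> simp [h, h']

theorem permSign_map [DecidableEq α] [DecidableEq β] {f : α → β} (hf : f.Injective)
    (l l' : List α) : permSign (l.map f) (l'.map f) = permSign l l' := by
  induction l generalizing l' with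
  | nil => simp [permSign]
  | cons a l ih =>
    have : (l'.map f).idxOf (f a) = l'.idxOf a := by
      induction l' with
      | nil => simp
      | cons b l' ih' =>
        simp only [map_cons, idxOf_cons, ih']
        have : (f b == f a) = (b == a) := by
          rw [Bool.eq_iff_iff, beq_iff_eq, beq_iff_eq, hf.eq_iff]
        rw [this]
    rw [map_cons, permSign, permSign, this, ← map_erase hf, ih]
    simp only [mem_map_of_injective hf]

end List

/-! ### Sign eigenvectors in an exterior power of a permutation representation -/

namespace Representation

open MonoidAlgebra

variable {k G X : Type*} [Field k] [Group G] [MulAction G X]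

/-- The pure wedge `x₁ ∧ ⋯ ∧ xₙ` of a list of `n` basis vectors (and `0` for lists of another
length). -/
noncomputable def wedge (k : Type*) {X : Type*} [Field k] (n : ℕ) (t : List X) :
    ⋀[k]^n (MonoidAlgebra k X) :=
  if ht : t.length = n then
    exteriorPower.ιMulti k n fun i => single (t[i.1]'(i.2.trans_eq ht.symm)) 1
  else 0

theorem wedge_ofFn {n : ℕ} (t : Fin n → X) :
    wedge k n (List.ofFn t) = exteriorPower.ιMulti k n fun i => single (t i) 1 := by
  simp [wedge]

theorem wedge_swapNeg (n : ℕ) : List.SwapNeg (wedge k n (X := X)) := by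
  intro p a b q
  have hl : (p ++ b :: a :: q).length = (p ++ a :: b :: q).length := by simp
  unfold wedge
  simp only [hl]
  split_ifs with hn
  · have hi : p.length < n := by rw [← hn]; simp
    have hj : p.length + 1 < n := by rw [← hn]; simp
    rw [← AlternatingMap.map_swap _ _ (i := ⟨p.length, hi⟩) (j := ⟨p.length + 1, hj⟩)
      (by simp [Fin.ext_iff])]
    congr 1
    funext x
    simp only [Function.comp]
    congr 1
    by_cases h1 : x = ⟨p.length, hi⟩
    · subst h1; simp
    by_cases h2 : x = ⟨p.length + 1, hj⟩
    · subst h2; simp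
    rw [Equiv.swap_apply_of_ne_of_ne h1 h2]
    simp only [Fin.ext_iff] at h1 h2
    rcases lt_or_ge x.1 p.length with h3 | h3
    · simp [List.getElem_append_left h3]
    · obtain ⟨m, h4⟩ : ∃ m, x.1 - p.length = m + 1 + 1 := ⟨x.1 - p.length - 2, by omega⟩
      simp only [List.getElem_append_right h3, h4, List.getElem_cons_succ]
  · simp

theorem exteriorPow_wedge (n : ℕ) (g : G) (t : List X) :
    (ofMulAction k G X).exteriorPow n g (wedge k n t) = wedge k n (t.map (g • ·)) := by
  unfold wedge
  simp only [List.length_map]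
  split_ifs
  · change exteriorPower.map n _ _ = _
    rw [exteriorPower.map_apply_ιMulti]
    congr 1
    funext i
    simp
  · simp

theorem span_range_wedge (n : ℕ) :
    Submodule.span k (Set.range (wedge k n (X := X))) = ⊤ := by
  refine top_le_iff.1 ?_
  rw [← exteriorPower.ιMulti_span_of_span k n (M := MonoidAlgebra k X)
    (s := Set.range fun x : X => single x (1 : k)) ?_]
  · refine Submodule.span_mono ?_
    rintro _ ⟨a, ha, rfl⟩
    choose t ht using fun i => ha (Set.mem_range_self i)
    exact ⟨List.ofFn t, by rw [wedge_ofFn]; exact congrArg _ (funext ht)⟩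
  · refine top_le_iff.1 fun v _ => ?_
    induction v using MonoidAlgebra.induction_linear with
    | zero => exact zero_mem _
    | add v w hv hw => exact add_mem (hv .intro) (hw .intro)
    | single x c =>
      have := Submodule.smul_mem _ c (Submodule.subset_span (R := k) (Set.mem_range_self
        (f := fun x : X => single x (1 : k)) x))
      simpa using this

/-- The coefficient of a linear combination of wedges at the wedge of `t`, as the determinant of the
matrix of coordinates at the `t j`. -/
noncomputable def wedgeCoeff {n : ℕ} (t : Fin n → X) : ⋀[k]^n (MonoidAlgebra k X) →ₗ[k] k :=
  exteriorPower.alternatingMapLinearEquiv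
    ((Matrix.detRowAlternating (n := Fin n) (R := k)).compLinearMap
      (LinearMap.pi fun j => Finsupp.lapply (t j) ∘ₗ (coeffLinearEquiv k).toLinearMap))

theorem wedgeCoeff_self {n : ℕ} {t : Fin n → X} (ht : t.Injective) :
    wedgeCoeff t (wedge k n (List.ofFn t)) = 1 := by
  classical
  rw [wedge_ofFn, wedgeCoeff, exteriorPower.alternatingMapLinearEquiv_apply_ιMulti]
  change Matrix.det _ = 1
  rw [← Matrix.det_one (R := k) (n := Fin n)]
  congr 1
  ext i j
  simp [Matrix.one_apply, Finsupp.single_apply, ht.eq_iff]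

theorem wedgeCoeff_eq_zero {n : ℕ} {t : Fin n → X} {u : List X} {x : X} (hx : x ∈ u)
    (hxt : ∀ i, t i ≠ x) : wedgeCoeff t (wedge k n u) = 0 := by
  unfold wedge
  split_ifs with hu
  · obtain ⟨i, hi, rfl⟩ := List.getElem_of_mem hx
    rw [wedgeCoeff, exteriorPower.alternatingMapLinearEquiv_apply_ιMulti]
    refine Matrix.det_eq_zero_of_row_eq_zero ⟨i, hu ▸ hi⟩ fun j => ?_
    simp [(hxt j).symm]
  · simp

variable [Fintype G] (χ : G →* k)

/-- The projection of a pure wedge to the eigenspace of `χ`, up to the factor `|G|`. -/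
noncomputable def twistedSum (n : ℕ) (t : List X) : ⋀[k]^n (MonoidAlgebra k X) :=
  ∑ g : G, χ g⁻¹ • wedge k n (t.map (g • ·))

theorem twistedSum_of_length_ne {n : ℕ} {t : List X} (ht : t.length ≠ n) :
    twistedSum χ n t = 0 := by
  simp [twistedSum, wedge, ht]

theorem twistedSum_swapNeg (n : ℕ) : List.SwapNeg (twistedSum χ n (X := X)) := by
  intro p a b q
  simp only [twistedSum, ← Finset.sum_neg_distrib]
  refine Finset.sum_congr rfl fun g _ => ?_
  simp only [List.map_append, List.map_cons]
  rw [wedge_swapNeg, smul_neg]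

theorem twistedSum_map_smul (n : ℕ) (g : G) (t : List X) :
    twistedSum χ n (t.map (g • ·)) = χ g • twistedSum χ n t := by
  rw [twistedSum, twistedSum, Finset.smul_sum]
  conv_rhs => rw [← Equiv.sum_comp (Equiv.mulRight g)]
  refine Finset.sum_congr rfl fun h _ => ?_
  rw [smul_smul, ← map_mul, Equiv.coe_mulRight, mul_inv_rev, mul_inv_cancel_left]
  simp [Function.comp_def, mul_smul]

/-- A group element `g` with `χ g = -1` that fixes all members of `t` kills the twisted sum. -/
theorem twistedSum_eq_zero [CharZero k] (n : ℕ) {g : G} {t : List X} (hg : χ g = -1)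
    (ht : ∀ x ∈ t, g • x = x) : twistedSum χ n t = 0 := by
  have h := twistedSum_map_smul χ n g t
  rw [List.map_congr_left (g := id) ht, List.map_id, hg] at h
  have h2 : (2 : k) • twistedSum χ n t = 0 := by
    calc (2 : k) • twistedSum χ n t = (1 : k) • twistedSum χ n t + twistedSum χ n t := by
          rw [two_smul, one_smul]
      _ = (1 : k) • twistedSum χ n t + (-1 : k) • twistedSum χ n t := by rw [← h]
      _ = 0 := by rw [← add_smul, add_neg_cancel, zero_smul]
  exact (smul_eq_zero.1 h2).resolve_left two_ne_zero

/-- The twisted sums span the eigenspace, since averaging over the group projects onto it. -/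
theorem eigenspace_exteriorPow_ofMulAction [CharZero k] (n : ℕ) :
    eigenspace ((ofMulAction k G X).exteriorPow n) χ =
      Submodule.span k (Set.range (twistedSum χ n)) := by
  let P : ⋀[k]^n (MonoidAlgebra k X) →ₗ[k] ⋀[k]^n (MonoidAlgebra k X) :=
    ∑ g : G, χ g⁻¹ • (ofMulAction k G X).exteriorPow n g
  have hP (t) : P (wedge k n t) = twistedSum χ n t := by
    simp [P, twistedSum, exteriorPow_wedge]
  refine le_antisymm (fun v hv => ?_) (Submodule.span_le.2 ?_)
  · have h1 : P v = (Fintype.card G : k) • v := by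
      have : ∀ g : G, χ g⁻¹ • (ofMulAction k G X).exteriorPow n g v = v := fun g => by
        rw [hv g, smul_smul, ← map_mul]; simp
      simp only [P, LinearMap.sum_apply, LinearMap.smul_apply, this, Finset.sum_const,
        Finset.card_univ, Nat.cast_smul_eq_nsmul]
    have h2 : P v ∈ Submodule.span k (Set.range (twistedSum χ n (X := X))) := by
      have : v ∈ Submodule.span k (Set.range (wedge k n (X := X))) := by
        rw [span_range_wedge]; trivial
      refine Submodule.span_induction ?_ ?_ ?_ ?_ this
      · rintro _ ⟨t, rfl⟩
        rw [hP]; exact Submodule.subset_span ⟨t, rfl⟩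
      · simp
      · intro v w _ _ hv hw; rw [map_add]; exact add_mem hv hw
      · intro c v _ hv; rw [map_smul]; exact Submodule.smul_mem _ _ hv
    rw [h1] at h2
    have h0 : (Fintype.card G : k) ≠ 0 := Nat.cast_ne_zero.2 Fintype.card_ne_zero
    simpa [smul_smul, h0] using Submodule.smul_mem _ (Fintype.card G : k)⁻¹ h2
  · rintro _ ⟨t, rfl⟩ g
    simp only [twistedSum, map_sum, map_smul, exteriorPow_wedge, List.map_map, Finset.smul_sum]
    conv_rhs => rw [← Equiv.sum_comp (Equiv.mulLeft g)]
    refine Finset.sum_congr rfl fun h _ => ?_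
    rw [smul_smul, Equiv.coe_mulLeft, mul_inv_rev, map_mul χ h⁻¹, mul_left_comm, ← map_mul,
      mul_inv_cancel, map_one, mul_one]
    simp [Function.comp_def, mul_smul]

/-- The functional `wedgeCoeff` separates the vectors `twistedSum χ n (t i)`, since a group element
that maps `t j` into `t i` exists only for `i = j`, and then contributes `1` to the
coefficient. -/
theorem linearIndependent_twistedSum [CharZero k] [DecidableEq X] {ι : Type*} {n : ℕ}
    {t : ι → List X}
    (hlen : ∀ i, (t i).length = n) (hnodup : ∀ i, (t i).Nodup)
    (hne : ∀ i j, ∀ g : G, (∀ x ∈ t j, g • x ∈ t i) → i = j)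
    (hsign : ∀ i, ∀ g : G, (∀ x ∈ t i, g • x ∈ t i) →
      ∃ ε : ℤ, ((t i).map (g • ·)).permSign (t i) = ε ∧ ε ≠ 0 ∧ (ε : k) = χ g) :
    LinearIndependent k fun i => twistedSum χ n (t i) := by
  choose u hu using fun i => (⟨fun j => (t i)[j.1]'(j.2.trans_eq (hlen i).symm), by
    refine List.ext_getElem (by simp [hlen]) (by simp)⟩ : ∃ u : Fin n → X, List.ofFn u = t i)
  have huinj (i) : (u i).Injective := by rw [← List.nodup_ofFn, hu]; exact hnodup i
  have hmem (i x) : x ∈ t i ↔ ∃ j, u i j = x := by rw [← hu, List.mem_ofFn]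
  -- the coefficient of a translate of `t j` at `t i` vanishes unless the translate lies in `t i`
  have hzero (i j) (g : G) (h : ¬ ∀ x ∈ t j, g • x ∈ t i) :
      wedgeCoeff (u i) (wedge k n ((t j).map (g • ·))) = 0 := by
    push Not at h
    obtain ⟨x, hx, hgx⟩ := h
    exact wedgeCoeff_eq_zero (List.mem_map.2 ⟨x, hx, rfl⟩) fun l hl =>
      hgx ((hmem i _).2 ⟨l, hl⟩)
  have hoff (i j) (hij : i ≠ j) : wedgeCoeff (u i) (twistedSum χ n (t j)) = 0 := by
    rw [twistedSum, map_sum]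
    refine Finset.sum_eq_zero fun g _ => ?_
    rw [map_smul, hzero _ _ _ fun h => hij (hne i j g h), smul_zero]
  have hdiag (i) : wedgeCoeff (u i) (twistedSum χ n (t i)) ≠ 0 := by
    classical
    have hterm (g : G) : χ g⁻¹ • wedgeCoeff (u i) (wedge k n ((t i).map (g • ·))) =
        if ∀ x ∈ t i, g • x ∈ t i then 1 else 0 := by
      split_ifs with h
      · obtain ⟨ε, hε, hε0, hεχ⟩ := hsign i g h
        rw [(wedge_swapNeg n).eq_permSign_smul (hε.trans_ne hε0), hε, map_zsmul, ← hu,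
          wedgeCoeff_self (huinj i), zsmul_one, hεχ, smul_eq_mul, ← map_mul]
        simp
      · rw [hzero _ _ _ h, smul_zero]
    simp only [twistedSum, map_sum, map_smul, hterm]
    rw [Finset.sum_boole]
    refine Nat.cast_ne_zero.2 (Finset.card_ne_zero.2 ⟨1, ?_⟩)
    simp
  rw [linearIndependent_iff']
  intro s c hc i hi
  have h := congrArg (wedgeCoeff (u i)) hc
  rw [map_sum, map_zero, Finset.sum_eq_single i] at h
  · rw [map_smul, smul_eq_mul] at h
    exact (mul_eq_zero.1 h).resolve_right (hdiag i)
  · intro j _ hj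
    rw [map_smul, hoff i j hj.symm, smul_zero]
  · exact fun h => absurd hi h

end Representation

/-! ### Computations with coordinate lists -/

/-! The following functions are made for evaluation by the kernel. Many of them are written with
recursors, which the kernel unfolds faster than recursive definitions, and with the functions on `ℕ`
and `ℤ` that underlie the usual notation. Since evaluation is lazy, the functions `force…` and
the functions with a continuation `k` serve to evaluate intermediate results once. -/

namespace Pic

/-- The coordinates `[a, b₁, …, b_r]` of a class `a h + ∑ bᵢ ℓᵢ`. -/
abbrev Code : Type := List ℤ

namespace Code

/-- The standard scalar product. -/
def dot (x : Code) : Code → ℤ :=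
  List.rec (motive := fun _ => Code → ℤ) (fun _ => 0)
    (fun a _ ih y => List.casesOn y 0 fun b y => Int.add (Int.mul a b) (ih y)) x

/-- The intersection pairing. -/
def pair (x y : Code) : ℤ :=
  List.casesOn x 0 fun a x => List.casesOn y 0 fun b y => Int.sub (Int.mul a b) (dot x y)

/-- The value `k n`, computed after the evaluation of `n`. -/
def force {α : Type} (n : ℕ) (k : ℕ → α) : α :=
  Nat.casesOn n (k 0) fun m => k (Nat.succ m)

/-- The value `k n`, computed after the evaluation of `n`. -/
def forceInt {α : Type} (n : ℤ) (k : ℤ → α) : α :=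
  match n with
  | Int.ofNat n => force n fun m => k (Int.ofNat m)
  | Int.negSucc n => force n fun m => k (Int.negSucc m)

/-- The image `x + (x, ρ) ρ` of `x` under the reflection in `ρ`. -/
def reflect (x ρ : Code) : Code :=
  forceInt (pair x ρ) fun m => List.zipWith (fun a b => Int.add a (Int.mul m b)) x ρ

/-- The value `k x`, computed after the evaluation of the entries of `x`. -/
def forceCode {α : Type} : Code → (Code → α) → α
  | [], k => k []
  | a :: x, k => forceInt a fun a => forceCode x fun x => k (a :: x)

/-- The value `k x`, computed after the evaluation of the members of `x`. -/
def forceCodes {α : Type} : List Code → (List Code → α) → α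
  | [], k => k []
  | a :: x, k => forceCode a fun a => forceCodes x fun x => k (a :: x)

/-- The vectors of length `n` with entries between `-3` and `1`, sum `s` and sum of squares `q`; the
Cauchy-Schwarz inequality prunes the search. -/
def vecs : ℕ → ℤ → ℤ → List Code
  | 0, s, q => if s = 0 ∧ q = 0 then [[]] else []
  | n + 1, s, q =>
    if s * s ≤ (n + 1) * q then
      ([-3, -2, -1, 0, 1] : List ℤ).flatMap fun x => (vecs n (s - x) (q - x * x)).map (x :: ·)
    else []

/-- The lines on `X_r`, for `r ≤ 8`; such a line has degree `a` between `-1` and `7`. -/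
def lines (r : ℕ) : List Code :=
  ([-1, 0, 1, 2, 3, 4, 5, 6, 7] : List ℤ).flatMap fun a =>
    (vecs r (1 - 3 * a) (a * a + 1)).map (a :: ·)

/-- The simple roots. -/
def simple (r : ℕ) : List Code :=
  (1 :: (List.range r).map fun i => if i < 3 then -1 else 0) ::
    (List.range (r - 1)).map fun i =>
      0 :: (List.range r).map fun j => if j = i then 1 else if j = i + 1 then -1 else 0

/-- The roots obtained from those in `l` by adding at most `n - 1` simple roots of `S`, one after
the other, such that each partial sum is again a root. -/
def rootsAbove (S : List Code) : ℕ → List Code → List Code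
  | 0, _ => []
  | n + 1, l => l ++ rootsAbove S n
      (l.flatMap fun ρ => (S.filter fun α => pair ρ α = 1).map (reflect ρ)).dedup

/-- Positive roots of `E_r`. The highest root of `E₈` has height `29`, so these are all positive
roots for `r ≤ 8`, though this fact is not needed. -/
def roots (r : ℕ) : List Code := rootsAbove (simple r) 29 (simple r)

/-! A set of lines is encoded by a natural number, its mask: the line with index `i` in the list of
lines stands for the bit `9 * i + 64`. The stride `9` leaves room for the base `512` digits from
which the masks are extracted. The lowest `64` bits hold a checksum of the others, modulo
`2 ^ 63 - 25`; it keeps apart masks in hash tables that see the lowest word of a numeral only. -/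

/-- The mask with bits `e` and the matching checksum. -/
def mask (e : ℕ) : ℕ := Nat.lor (Nat.shiftLeft e 64) (Nat.mod e 9223372036854775783)

/-- The mask of an intersection. -/
def inter (a b : ℕ) : ℕ := mask (Nat.shiftRight (Nat.land a b) 64)
/-- The mask of a difference. -/
def diff (a b : ℕ) : ℕ := mask (Nat.shiftRight (Nat.xor a (Nat.land a b)) 64)
/-- The mask of a union. -/
def union (a b : ℕ) : ℕ := mask (Nat.shiftRight (Nat.lor a b) 64)

/-- The number with `n` digits `1` in base `512`. -/
def ones : ℕ → ℕ
  | 0 => 0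
  | n + 1 => 1 + 512 * ones n

/-- The linear combination `∑ 512 ^ i * Lᵢ` of the members `Lᵢ` of a list of classes. Its pairing
with a class `v` packs all pairings `(v, Lᵢ)` into one number. -/
def columns {α : Type} (r : ℕ) : List Code → (Code → α) → α
  | [], k => k (List.replicate (r + 1) 0)
  | l :: ls, k => columns r ls fun acc =>
      forceCode (List.zipWith (fun a s => Int.add a (Int.mul 512 s)) l acc) k

/-- The lines of `X_r`, prepared for the computation of pairings with all of them at once. -/
structure Table where
  /-- The lines. -/
  lines : List Code
  /-- The combination `∑ 512 ^ i * Lᵢ` of the lines. -/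
  columns : Code
  /-- The number `∑ 512 ^ i`. -/
  ones : ℕ

/-- The mask of the lines `L` with `(x, L) ≥ v`, where `P = (x, c.columns)`: adding `256 - v` to all
digits makes them nonnegative, and the bit `8` of a digit tells whether it is at least `256`. -/
def Table.geMask (c : Table) (P : ℤ) (v : ℕ) : ℕ :=
  mask (Nat.land (Nat.shiftRight
    (Int.toNat (Int.add P (Int.ofNat (Nat.mul (Nat.sub 256 v) c.ones)))) 8) c.ones)

/-- For each root of a list, the masks of the lines with negative and with zero pairing. -/
def Table.rootMasks {α : Type} (c : Table) : List Code → (List (ℕ × ℕ) → α) → α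
  | [], k => k []
  | ρ :: ρs, k =>
    forceInt (pair ρ c.columns) fun P =>
    force (c.geMask P 0) fun g =>
    force (diff (mask c.ones) g) fun n =>
    force (diff g (c.geMask P 1)) fun o =>
    c.rootMasks ρs fun Φ => k ((n, o) :: Φ)

/-- The positions of the nonzero bits of `m < 2 ^ 2 ^ k`, shifted by `b` and followed by `tl`,
found by bisection. -/
def bitsFrom (k m b : ℕ) (tl : List ℕ) : List ℕ :=
  Nat.rec (motive := fun _ => ℕ → ℕ → List ℕ → List ℕ)
    (fun m b tl => Nat.casesOn m tl fun _ => force b fun b => b :: tl)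
    (fun k ih m b tl => Nat.casesOn m tl fun _ =>
      ih (Nat.mod m (Nat.pow 2 (Nat.pow 2 k))) b
        (ih (Nat.shiftRight m (Nat.pow 2 k)) (Nat.add b (Nat.pow 2 k)) tl)) k m b tl

/-- The nonzero bits of a mask, without those of the checksum. -/
def bits (m : ℕ) : List ℕ := bitsFrom 12 (Nat.shiftRight m 64) 64 []

/-- The two parts into which `g` divides the block `C`: the part inside `g`, unless it is empty, and
then the blocks that `k` produces from the part outside `g`. -/
def split (g C : ℕ) (k : ℕ → List ℕ) : List ℕ :=
  force (inter C g) fun D => force (diff C D) fun R =>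
    Nat.casesOn D (k R) fun D' => Nat.succ D' :: k R

/-- The blocks `Bs`, each divided according to the pairing of its members with `v`, in the order
`0`, `2`, then `1` or `3`, then negative values. This order keeps the search small. -/
def Table.refine (c : Table) (v : Code) (Bs : List ℕ) : List ℕ :=
  forceInt (pair v c.columns) fun P =>
  force (c.geMask P 0) fun g0 =>
  force (c.geMask P 1) fun g1 =>
  force (c.geMask P 2) fun g2 =>
  force (c.geMask P 3) fun g3 =>
  force (diff g0 g1) fun e0 =>
  force (diff g2 g3) fun e2 =>
  Bs.flatMap fun C => split e0 C fun C => split e2 C fun C => split g1 C fun C =>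
    Nat.casesOn C [] fun C' => [Nat.succ C']

/-- The results of `f b Cs` for all pairs `(B, Cs)` of the list and all members `b` of `B` outside
`bad`. -/
def extend (f : ℕ → List ℕ → List (List Code)) (bad : ℕ) :
    List (ℕ × List ℕ) → List (List Code)
  | [] => []
  | B :: Bs => ((bits (diff B.1 bad)).flatMap fun b => f b B.2) ++ extend f bad Bs

/-- Each block, paired with the blocks from it onwards. -/
def tails : List ℕ → List (ℕ × List ℕ)
  | [] => []
  | C :: Bs => (C, C :: Bs) :: tails Bs

/-- Each block, paired with the union of the blocks from it onwards; also the union of all blocks.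
-/
def unions : List ℕ → (List (ℕ × List ℕ) → ℕ → List (List Code)) → List (List Code)
  | [], k => k [] 0
  | C :: Bs, k => unions Bs fun l U => force (union C U) fun U => k ((C, [U]) :: l) U

/-- The roots of `Φ` that are orthogonal to the line with bit `b`. -/
def orthogonal {α : Type} (b : ℕ) (Φ : List (ℕ × ℕ)) (k : List (ℕ × ℕ) → α) : α :=
  List.rec (motive := fun _ => (List (ℕ × ℕ) → α) → α) (fun k => k [])
    (fun ρ _ ih k => Nat.casesOn (Nat.land (Nat.shiftRight ρ.2 b) 1) (ih k)
      fun _ => ih fun Φ => k (ρ :: Φ)) Φ k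

/-- The union of the masks `f ρ`. -/
def bad (f : ℕ × ℕ → ℕ) (Φ : List (ℕ × ℕ)) : ℕ :=
  List.rec 0 (fun ρ _ ih => Nat.lor (f ρ) ih) Φ

/-- The line with bit `b`. -/
def Table.lineAt (c : Table) (b : ℕ) : Code := c.lines.getD ((b - 64) / 9) []

/-- The extensions of `p` by `n + 1` lines from the blocks `Bs` that the search has to consider,
where `Φ` holds the masks of the positive roots orthogonal to `p`. The next line is dominant for
`Φ`, the last one strictly dominant, and lines are taken from the blocks in order. For the last two
lines it does not pay to refine the blocks. -/
def Table.search (c : Table) : ℕ → List Code → List (ℕ × ℕ) → List ℕ → List (List Code)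
  | 0, p, Φ, Bs =>
    (bits (diff (Bs.foldr Nat.lor 0) (bad (fun ρ => Nat.lor ρ.1 ρ.2) Φ))).map
      fun b => c.lineAt b :: p
  | n + 1, p, Φ, Bs =>
    force (mask (Nat.shiftRight (bad Prod.fst Φ) 64)) fun m =>
    Nat.casesOn n
      (unions Bs fun Bs _ => extend (fun b Cs => orthogonal b Φ fun Φ =>
        c.search n (c.lineAt b :: p) Φ Cs) m Bs)
      fun _ => extend (fun b Cs => orthogonal b Φ fun Φ =>
        c.search n (c.lineAt b :: p) Φ (c.refine (c.lineAt b) Cs)) m (tails Bs)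

/-- The value of `k` at the table of the lines on `X_r`. -/
def withTable {α : Type} (r : ℕ) (k : Table → α) : α :=
  forceCodes (lines r) fun ls => columns r ls fun cs =>
    force (ones ls.length) fun o => k ⟨ls, cs, o⟩

/-- The lists of `r - 2` lines that are not excluded by the search. -/
def survivors (r : ℕ) : List (List Code) :=
  withTable r fun c => c.rootMasks (roots r) fun Φ => c.search (r - 3) [] Φ [mask c.ones]

end Code

/-! ### Coordinate lists and classes -/

/-- The coordinate list of a class. -/
def code {r : ℕ} (x : Pic r) : Code := x.1 :: List.ofFn x.2

theorem code_injective {r : ℕ} : (code (r := r)).Injective := by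
  intro x y h
  obtain ⟨h1, h2⟩ := List.cons.inj h
  exact Prod.ext h1 (List.ofFn_injective h2)

theorem exists_code_eq {r : ℕ} {c : Code} (hc : c.length = r + 1) : ∃ x : Pic r, code x = c := by
  obtain _ | ⟨a, b⟩ := c
  · simp at hc
  · have hb : b.length = r := by simpa using hc
    subst hb
    exact ⟨(a, b.get), by simp [code]⟩

namespace Code

theorem dot_ofFn {n : ℕ} (f g : Fin n → ℤ) : dot (List.ofFn f) (List.ofFn g) = ∑ i, f i * g i := by
  induction n with
  | zero => simp [dot]
  | succ n ih =>
    rw [List.ofFn_succ, List.ofFn_succ, Fin.sum_univ_succ, ← ih]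
    rfl

theorem pair_code {r : ℕ} (x y : Pic r) : pair (code x) (code y) = pairing r x y := by
  rw [pairing_apply, ← dot_ofFn]
  rfl

theorem zipWith_code {r : ℕ} (c : ℤ) (x y : Pic r) :
    List.zipWith (fun a b => Int.add a (Int.mul c b)) (code x) (code y) = code (x + c • y) := by
  simp only [code, List.zipWith_cons_cons]
  congr 1
  refine List.ext_getElem (by simp) fun i _ _ => ?_
  simp

@[simp]
theorem force_eq {α : Type} (n : ℕ) (k : ℕ → α) : force n k = k n := by
  cases n <;> rfl

@[simp]
theorem forceInt_eq {α : Type} (n : ℤ) (k : ℤ → α) : forceInt n k = k n := by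
  cases n <;> simp [forceInt]

theorem reflect_code {r : ℕ} (x ρ : Pic r) :
    reflect (code x) (code ρ) = code (x + pairing r x ρ • ρ) := by
  rw [reflect, forceInt_eq, pair_code, zipWith_code]

@[simp]
theorem forceCode_eq {α : Type} (x : Code) (k : Code → α) : forceCode x k = k x := by
  induction x generalizing k with
  | nil => rfl
  | cons a x ih => simp [forceCode, ih]

@[simp]
theorem forceCodes_eq {α : Type} (x : List Code) (k : List Code → α) :
    forceCodes x k = k x := by
  induction x generalizing k with
  | nil => rfl
  | cons a x ih => simp [forceCodes, ih]

/-! ### Correctness of the operations on masks -/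

theorem testBit_mask (e j : ℕ) : (mask e).testBit (j + 64) = e.testBit j := by
  change (e <<< 64 ||| e % 9223372036854775783).testBit (j + 64) = _
  rw [Nat.testBit_lor, Nat.testBit_shiftLeft, Nat.testBit_lt_two_pow (x := e % _)]
  · simp
  · calc e % 9223372036854775783 < 9223372036854775783 := Nat.mod_lt _ (by norm_num)
      _ ≤ 2 ^ 64 := by norm_num
      _ ≤ 2 ^ (j + 64) := Nat.pow_le_pow_right (by norm_num) (by omega)

theorem testBit_inter (a b j : ℕ) :
    (inter a b).testBit (j + 64) = (a.testBit (j + 64) && b.testBit (j + 64)) := by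
  rw [inter, testBit_mask]
  change ((a &&& b) >>> 64).testBit j = _
  rw [Nat.testBit_shiftRight, Nat.testBit_land, add_comm]

theorem testBit_diff (a b j : ℕ) :
    (diff a b).testBit (j + 64) = (a.testBit (j + 64) && !b.testBit (j + 64)) := by
  rw [diff, testBit_mask]
  change ((a ^^^ (a &&& b)) >>> 64).testBit j = _
  rw [Nat.testBit_shiftRight, Nat.testBit_xor, Nat.testBit_land, add_comm]
  cases a.testBit (j + 64) <;> simp

theorem testBit_union (a b j : ℕ) :
    (union a b).testBit (j + 64) = (a.testBit (j + 64) || b.testBit (j + 64)) := by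
  rw [union, testBit_mask]
  change ((a ||| b) >>> 64).testBit j = _
  rw [Nat.testBit_shiftRight, Nat.testBit_lor, add_comm]

theorem testBit_bad (f : ℕ × ℕ → ℕ) (Φ : List (ℕ × ℕ)) (j : ℕ) :
    (bad f Φ).testBit j ↔ ∃ ρ ∈ Φ, (f ρ).testBit j := by
  induction Φ with
  | nil => simp [bad]
  | cons ρ Φ ih =>
    change (f ρ ||| bad f Φ).testBit j ↔ _
    simp [ih]

theorem mem_bitsFrom_of_mem (k m b : ℕ) {tl : List ℕ} {x : ℕ} (hx : x ∈ tl) :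
    x ∈ bitsFrom k m b tl := by
  induction k generalizing m b tl with
  | zero =>
    cases m with
    | zero => exact hx
    | succ m =>
      change x ∈ force b fun b => b :: tl
      simp [hx]
  | succ k ih =>
    cases m with
    | zero => exact hx
    | succ m => exact ih _ _ (ih _ _ hx)

theorem add_mem_bitsFrom (k : ℕ) {m i : ℕ} (b : ℕ) (tl : List ℕ) (hi : i < 2 ^ k)
    (hm : m.testBit i) : b + i ∈ bitsFrom k m b tl := by
  induction k generalizing m b tl i with
  | zero =>
    obtain rfl : i = 0 := by simpa using hi
    cases m with
    | zero => simp at hm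
    | succ m =>
      change b + 0 ∈ force b fun b => b :: tl
      simp
  | succ k ih =>
    obtain _ | n := m
    · simp at hm
    change b + i ∈ bitsFrom k ((n + 1) % 2 ^ 2 ^ k) b
      (bitsFrom k ((n + 1) >>> 2 ^ k) (b + 2 ^ k) tl)
    rcases lt_or_ge i (2 ^ k) with h | h
    · exact ih _ _ h (by simp [Nat.testBit_mod_two_pow, h, hm])
    · refine mem_bitsFrom_of_mem _ _ _ ?_
      obtain ⟨j, rfl⟩ := Nat.exists_eq_add_of_le h
      rw [← add_assoc]
      exact ih _ _ (by rw [pow_succ] at hi; omega) (by rw [Nat.testBit_shiftRight]; exact hm)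

theorem mem_bits {m j : ℕ} (hj : j < 4096) (hm : m.testBit (j + 64)) : j + 64 ∈ bits m := by
  rw [bits, add_comm]
  refine add_mem_bitsFrom 12 _ _ (by simpa using hj) ?_
  change (m >>> 64).testBit j
  rwa [Nat.testBit_shiftRight, add_comm]

/-- The integer with base `512` digits `l`, lowest digit first. -/
def packed {R : Type*} [Semiring R] (l : List R) : R := l.foldr (fun a s => a + 512 * s) 0

theorem testBit_packed {l : List ℕ} (hl : ∀ a ∈ l, a < 512) {i : ℕ} (hi : i < l.length) {j : ℕ}
    (hj : j < 9) : (packed l).testBit (9 * i + j) = l[i].testBit j := by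
  induction l generalizing i with
  | nil => simp at hi
  | cons a l ih =>
    have ha : a < 2 ^ 9 := hl a (by simp)
    change (a + 2 ^ 9 * packed l).testBit _ = _
    rw [add_comm, Nat.testBit_two_pow_mul_add _ ha]
    cases i with
    | zero => simp [hj]
    | succ i =>
      rw [if_neg (by omega), show 9 * (i + 1) + j - 9 = 9 * i + j by omega,
        ih (fun b hb => hl b (by simp [hb])) (by simpa using hi)]
      simp

theorem ones_eq (n : ℕ) : ones n = packed (List.replicate n 1) := by
  induction n with
  | zero => rfl
  | succ n ih => rw [ones, ih]; rfl

theorem packed_add (l : List ℤ) (e : ℤ) :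
    packed l + e * ones l.length = packed (l.map (· + e)) := by
  induction l with
  | nil => simp [packed, ones]
  | cons a l ih =>
    change a + 512 * packed l + e * ((1 + 512 * ones l.length : ℕ) : ℤ) =
      a + e + 512 * packed (l.map (· + e))
    rw [← ih]; push_cast; ring

theorem packed_toNat {l : List ℤ} (hl : ∀ a ∈ l, 0 ≤ a) :
    packed l = ((packed (l.map Int.toNat) : ℕ) : ℤ) := by
  induction l with
  | nil => rfl
  | cons a l ih =>
    change a + 512 * packed l = ((a.toNat + 512 * packed (l.map Int.toNat) : ℕ) : ℤ)
    rw [ih fun b hb => hl b (by simp [hb])]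
    push_cast
    rw [Int.toNat_of_nonneg (hl a (by simp))]

theorem testBit_geMask {c : Table} {l : List ℤ} (hl : ∀ a ∈ l, |a| ≤ 250)
    (hc : c.ones = ones l.length) {v : ℕ} (hv : v ≤ 3) {i : ℕ} (hi : i < l.length) :
    (c.geMask (packed l) v).testBit (9 * i + 64) = decide ((v : ℤ) ≤ l[i]) := by
  have he : ((256 - v : ℕ) : ℤ) = 256 - v := by omega
  have hpos : ∀ a ∈ l.map (· + ((256 - v : ℕ) : ℤ)), 0 ≤ a := by
    intro a ha
    obtain ⟨b, hb, rfl⟩ := List.mem_map.1 ha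
    have := abs_le.1 (hl b hb)
    omega
  rw [Table.geMask, testBit_mask]
  change (((packed l + ((((256 - v) * c.ones : ℕ)) : ℤ)).toNat >>> 8) &&& c.ones).testBit _ = _
  have h8 := testBit_packed (l := (l.map (· + ((256 - v : ℕ) : ℤ))).map Int.toNat) (i := i)
    (j := 8) (by
      intro a ha
      simp only [List.mem_map] at ha
      obtain ⟨_, ⟨b, hb, rfl⟩, rfl⟩ := ha
      have := abs_le.1 (hl b hb)
      omega) (by simpa using hi) (by norm_num)
  have h0 := testBit_packed (l := List.replicate l.length 1) (i := i) (j := 0) (by simp)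
    (by simpa using hi) (by norm_num)
  rw [Nat.cast_mul, hc, packed_add, packed_toNat hpos, Int.toNat_natCast, Nat.testBit_land,
    Nat.testBit_shiftRight, ones_eq, add_comm 8, h8, ← add_zero (9 * i), h0]
  simp only [List.getElem_map, List.getElem_replicate]
  have h1 := abs_le.1 (hl l[i] (List.getElem_mem hi))
  obtain ⟨d, hd⟩ := Int.eq_ofNat_of_zero_le (show 0 ≤ l[i] + ((256 - v : ℕ) : ℤ) by omega)
  rw [hd, Int.toNat_natCast]
  have hd2 : d < 512 := by omega
  have : d.testBit 8 = decide (256 ≤ d) := by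
    rw [Nat.testBit_eq_decide_div_mod_eq]
    congr 1
    rw [eq_iff_iff]
    omega
  rw [this]
  simp only [Nat.testBit_zero, Nat.one_mod, decide_true, Bool.and_true]
  congr 1
  rw [eq_iff_iff]
  omega

end Code

/-! ### Roots and the Weyl group -/

variable {r : ℕ}

/-- The reflection in `w ρ` is the conjugate by `w` of the reflection in `ρ`. -/
theorem exists_reflection_eq_conj (w : weylGroup r) (ρ : Root r) :
    ∃ ρ' : Root r, ρ'.1 = w.1 ρ.1 ∧ reflection ρ' = w.1 * reflection ρ * w.1⁻¹ := by
  have hw := weylGroup_preserves w.2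
  refine ⟨⟨w.1 ρ.1, ?_, by rw [hw.2]; exact ρ.2.2⟩, rfl, ?_⟩
  · have := hw.2 ρ.1 (K r)
    rw [hw.1] at this
    exact this.trans ρ.2.1
  · refine LinearEquiv.ext fun d => ?_
    have hd : w.1 (w.1⁻¹ d) = d := w.1.apply_symm_apply d
    have hp : pairing r (w.1⁻¹ d) ρ.1 = pairing r d (w.1 ρ.1) := by rw [← hw.2, hd]
    simp only [LinearEquiv.mul_apply, reflection_apply, map_add, map_smul, hd, hp]

/-- A linear functional that is positive on the simple roots. -/
def height (x : Pic r) : ℤ := pairing r (1, fun i => (i : ℤ) + 1) x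

theorem height_simpleRoot_pos (h4 : 4 ≤ r) (h8 : r ≤ 8) (i : Fin r) :
    0 < height (simpleRoot r i) := by
  unfold height
  rw [← Code.pair_code]
  revert i
  interval_cases r <;> decide +kernel

/-- A positive root whose reflection lies in the Weyl group. -/
def IsPosRoot (ρ : Root r) : Prop := reflection ρ ∈ weylGroup r ∧ 0 < height ρ.1

/-- If `(ρ, α) = 1`, then `ρ + α` is the image of `ρ` under the reflection in `α`. -/
theorem IsPosRoot.exists_add {ρ α : Root r} (hρ : IsPosRoot ρ) (hα : IsPosRoot α)
    (h : pairing r ρ.1 α.1 = 1) : ∃ β : Root r, β.1 = ρ.1 + α.1 ∧ IsPosRoot β := by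
  obtain ⟨β, hβ, hβ'⟩ := exists_reflection_eq_conj ⟨reflection α, hα.1⟩ ρ
  have hβ : β.1 = ρ.1 + α.1 := by simpa [reflection_apply, h] using hβ
  refine ⟨β, hβ, ?_, ?_⟩
  · rw [hβ']
    exact mul_mem (mul_mem hα.1 hρ.1) (inv_mem hα.1)
  · have := hρ.2; have := hα.2
    simp only [hβ, height, map_add] at *
    omega

namespace Code

theorem exists_of_mem_simple (h4 : 4 ≤ r) (h8 : r ≤ 8) {c : Code} (hc : c ∈ simple r) :
    ∃ ρ : Root r, code ρ.1 = c ∧ IsPosRoot ρ := by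
  have key : ∀ c ∈ simple r, ∃ i : Fin r, code (simpleRoot r i) = c := by
    interval_cases r <;> decide +kernel
  obtain ⟨i, hi⟩ := key c hc
  refine ⟨⟨simpleRoot r i, simpleRoot_isRoot (by omega) i⟩, hi, ?_, height_simpleRoot_pos h4 h8 i⟩
  exact Subgroup.subset_closure ⟨_, ⟨i, rfl⟩, rfl⟩

theorem exists_of_mem_roots (h4 : 4 ≤ r) (h8 : r ≤ 8) {c : Code} (hc : c ∈ roots r) :
    ∃ ρ : Root r, code ρ.1 = c ∧ IsPosRoot ρ := by
  suffices H : ∀ (n : ℕ) (l : List Code), (∀ c ∈ l, ∃ ρ : Root r, code ρ.1 = c ∧ IsPosRoot ρ) →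
      ∀ c ∈ rootsAbove (simple r) n l, ∃ ρ : Root r, code ρ.1 = c ∧ IsPosRoot ρ from
    H _ _ (fun c => exists_of_mem_simple h4 h8) c hc
  intro n
  induction n with
  | zero => simp [rootsAbove]
  | succ n ih =>
    intro l hl c hc
    rcases List.mem_append.1 hc with hc | hc
    · exact hl c hc
    · refine ih _ (fun c hc => ?_) c hc
      simp only [List.mem_dedup, List.mem_flatMap, List.mem_map, List.mem_filter,
        decide_eq_true_eq] at hc
      obtain ⟨d, hd, e, ⟨he, hde⟩, rfl⟩ := hc
      obtain ⟨ρ, rfl, hρ⟩ := hl d hd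
      obtain ⟨α, rfl, hα⟩ := exists_of_mem_simple h4 h8 he
      rw [pair_code] at hde
      obtain ⟨β, hβ, hβ'⟩ := hρ.exists_add hα hde
      exact ⟨β, by rw [reflect_code, hde, hβ, one_smul], hβ'⟩

/-! ### The list of lines -/

theorem ofFn_mem_vecs {n : ℕ} (b : Fin n → ℤ) (hb : ∀ i, -3 ≤ b i ∧ b i ≤ 1) :
    List.ofFn b ∈ vecs n (∑ i, b i) (∑ i, b i * b i) := by
  induction n with
  | zero => simp [vecs]
  | succ n ih =>
    have hcs : (∑ i, b i) * (∑ i, b i) ≤ ((n : ℤ) + 1) * ∑ i, b i * b i := by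
      have := sq_sum_le_card_mul_sum_sq (s := Finset.univ) (f := b)
      simpa [sq] using this
    rw [vecs, if_pos hcs, List.mem_flatMap]
    refine ⟨b 0, ?_, List.mem_map.2 ⟨List.ofFn fun i : Fin n => b i.succ, ?_, ?_⟩⟩
    · have := hb 0
      generalize b 0 = x at *
      obtain ⟨h1, h2⟩ := this
      interval_cases x <;> simp
    · have := ih (fun i => b i.succ) fun i => hb i.succ
      rw [Fin.sum_univ_succ, Fin.sum_univ_succ, add_sub_cancel_left, add_sub_cancel_left]
      exact this
    · rw [List.ofFn_succ]

theorem length_of_mem_vecs {n : ℕ} {s q : ℤ} {c : Code} (hc : c ∈ vecs n s q) : c.length = n := by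
  induction n generalizing s q c with
  | zero =>
    rw [vecs] at hc
    split_ifs at hc
    · simpa using hc
    · simp at hc
  | succ n ih =>
    rw [vecs] at hc
    split_ifs at hc
    · simp only [List.mem_flatMap, List.mem_map] at hc
      obtain ⟨_, _, d, hd, rfl⟩ := hc
      simp [ih hd]
    · simp at hc

theorem length_of_mem_lines {c : Code} (hc : c ∈ lines r) : c.length = r + 1 := by
  simp only [lines, List.mem_flatMap, List.mem_map] at hc
  obtain ⟨_, _, d, hd, rfl⟩ := hc
  simp [length_of_mem_vecs hd]

/-- The list `lines r` is complete: `(∑ bᵢ)² ≤ r ∑ bᵢ²` bounds the degree `a` of a line, and the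
same inequality without `bᵢ` bounds the coordinate `bᵢ`. -/
theorem code_mem_lines (h8 : r ≤ 8) (x : Line r) : code x.1 ∈ lines r := by
  obtain ⟨⟨a, b⟩, hK, hq⟩ := x
  have hKa : ∀ i, (K r).2 i = 1 := by
    intro i; simp [K, h, l, Prod.snd_sum, Finset.sum_apply, Pi.single_apply]
  have hKb : (K r).1 = -3 := by simp [K, h, l, Prod.fst_sum]
  have hs : ∑ i, b i = 1 - 3 * a := by
    simp only [pairing_apply, hKa, hKb, one_mul] at hK
    linarith
  have hq : ∑ i, b i * b i = a * a + 1 := by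
    simp only [pairing_apply] at hq
    linarith
  have hr : (r : ℤ) ≤ 8 := by exact_mod_cast h8
  have ha : -1 ≤ a ∧ a ≤ 7 := by
    have h1 := sq_sum_le_card_mul_sum_sq (s := Finset.univ) (f := b)
    simp only [Finset.card_univ, Fintype.card_fin, sq, hs, hq] at h1
    have h2 : (r : ℤ) * (a * a + 1) ≤ 8 * (a * a + 1) :=
      mul_le_mul_of_nonneg_right hr (by nlinarith)
    constructor <;> nlinarith
  have hb : ∀ i, -3 ≤ b i ∧ b i ≤ 1 := by
    intro i
    have h1 := sq_sum_le_card_mul_sum_sq (s := Finset.univ.erase i) (f := b)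
    have h2 := Finset.add_sum_erase Finset.univ b (Finset.mem_univ i)
    have h3 := Finset.add_sum_erase Finset.univ (fun i => b i * b i) (Finset.mem_univ i)
    have hn : 0 ≤ ∑ j ∈ Finset.univ.erase i, b j * b j :=
      Finset.sum_nonneg fun j _ => mul_self_nonneg _
    have hcard : ((Finset.univ.erase i).card : ℤ) ≤ 7 := by
      rw [Finset.card_erase_of_mem (Finset.mem_univ i), Finset.card_univ, Fintype.card_fin]
      omega
    rw [hs] at h2
    rw [hq] at h3
    simp only [sq] at h1
    have h4 := h1.trans (mul_le_mul_of_nonneg_right hcard hn)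
    have e2 : ∑ j ∈ Finset.univ.erase i, b j = 1 - 3 * a - b i := by linarith
    have e3 : ∑ j ∈ Finset.univ.erase i, b j * b j = a * a + 1 - b i * b i := by linarith
    rw [e2, e3] at h4
    generalize b i = y at h4
    -- the discriminant in `a` of the quadratic inequality `h4` is `-28 (y + 3) (y - 1)`
    have h5 : (y + 3) * (y - 1) ≤ 0 := by nlinarith [sq_nonneg (2 * a + 3 * y - 3)]
    constructor <;> nlinarith
  simp only [lines, List.mem_flatMap, List.mem_map]
  refine ⟨a, ?_, List.ofFn b, ?_, rfl⟩
  · obtain ⟨h1, h2⟩ := ha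
    interval_cases a <;> simp
  · rw [← hs, ← hq]
    exact ofFn_mem_vecs b hb

/-! ### The table of pairings -/

theorem columns_eq {ls : List Code} (hls : ∀ c ∈ ls, c.length = r + 1) :
    ∃ X : Pic r, (∀ {α : Type} (k : Code → α), columns r ls k = k (code X)) ∧
      ∀ v : Pic r, pairing r v X = packed (ls.map (pair (code v))) := by
  induction ls with
  | nil =>
    refine ⟨0, fun k => ?_, fun v => by simp [packed]⟩
    rw [columns, List.replicate_succ]
    congr 2
    refine List.ext_getElem (by simp) fun i _ _ => ?_
    simp
  | cons c ls ih =>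
    obtain ⟨X, hX, hX'⟩ := ih fun d hd => hls d (by simp [hd])
    obtain ⟨x, rfl⟩ := exists_code_eq (hls c (by simp))
    refine ⟨x + (512 : ℤ) • X, fun k => ?_, fun v => ?_⟩
    · rw [columns, hX, forceCode_eq]
      exact congrArg k (zipWith_code 512 x X)
    · rw [map_add, map_smul, hX']
      simp [packed, pair_code]

/-- All coordinates are at most `7` in absolute value. -/
def small (c : Code) : Bool := c.all fun a => Nat.ble a.natAbs 7

/-- The absolute values of the coordinates add up to at most `31`. -/
def short (c : Code) : Bool := Nat.ble (c.foldr (fun a s => a.natAbs + s) 0) 31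

theorem abs_pairing_le {x y : Pic r} (hx : short (code x)) (hy : small (code y)) :
    |pairing r x y| ≤ 250 := by
  have h1 : |x.1| + ∑ i, |x.2 i| ≤ 31 := by
    rw [short, Nat.ble_eq, code, List.foldr_cons] at hx
    have : (List.ofFn x.2).foldr (fun a s => a.natAbs + s) 0 = ∑ i, (x.2 i).natAbs := by
      rw [← List.sum_ofFn, List.sum_eq_foldr, ← Function.comp_def, ← List.map_ofFn,
        List.foldr_map]
    rw [this] at hx
    simp only [Int.abs_eq_natAbs]
    exact_mod_cast hx
  have h2 : |y.1| ≤ 7 ∧ ∀ i, |y.2 i| ≤ 7 := by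
    simp only [small, code, List.all_cons, Bool.and_eq_true, List.all_eq_true, Nat.ble_eq,
      List.mem_ofFn, forall_exists_index, forall_apply_eq_imp_iff] at hy
    simp only [Int.abs_eq_natAbs]
    exact_mod_cast hy
  rw [pairing_apply]
  calc |x.1 * y.1 - ∑ i, x.2 i * y.2 i| ≤ |x.1 * y.1| + |∑ i, x.2 i * y.2 i| := abs_sub _ _
    _ ≤ |x.1| * 7 + ∑ i, |x.2 i| * 7 := by
        refine add_le_add ?_ ((Finset.abs_sum_le_sum_abs _ _).trans
          (Finset.sum_le_sum fun i _ => ?_))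
        · rw [abs_mul]; exact mul_le_mul_of_nonneg_left h2.1 (abs_nonneg _)
        · rw [abs_mul]; exact mul_le_mul_of_nonneg_left (h2.2 i) (abs_nonneg _)
    _ = (|x.1| + ∑ i, |x.2 i|) * 7 := by rw [← Finset.sum_mul, add_mul]
    _ ≤ 250 := by linarith

/-- The bounds that make the packed pairings free of carries: by `abs_pairing_le`, lines and roots
have pairings of absolute value at most `250` with all lines. The last condition bounds the masks.
-/
def bounded (r : ℕ) : Bool :=
  (lines r).all (fun c => small c && short c) && (roots r).all short &&
    Nat.ble (lines r).length 400

set_option maxRecDepth 100000 in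
theorem bounded_eq_true (h4 : 4 ≤ r) (h8 : r ≤ 8) : bounded r = true := by
  interval_cases r <;> decide +kernel

end Code

/-! ### Exhaustiveness of the search -/

theorem finite_line (h8 : r ≤ 8) : Finite (Line r) := by
  refine Finite.of_injective (β := {c : Code // c ∈ Code.lines r})
    (fun x => ⟨code x.1, Code.code_mem_lines h8 x⟩) fun x y h => ?_
  exact Subtype.ext (code_injective (congrArg Subtype.val h))

/-- Every line can be moved into the dominant chamber of the reflections fixing `p`, by a group
element that fixes `p`: take an image of smallest height. -/
theorem exists_dominant [Finite (Line r)] (p : List (Line r)) (x : Line r) :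
    ∃ w : weylGroup r, (∀ y ∈ p, w • y = y) ∧ ∀ ρ : Root r, IsPosRoot ρ →
      (∀ y ∈ p, pairing r y.1 ρ.1 = 0) → 0 ≤ pairing r (w • x).1 ρ.1 := by
  obtain ⟨_, ⟨w, hw, rfl⟩, hmin⟩ := Set.exists_min_image
    {z | ∃ w : weylGroup r, (∀ y ∈ p, w • y = y) ∧ w • x = z} (fun z => height z.1)
    (Set.toFinite _) ⟨x, 1, by simp, by simp⟩
  refine ⟨w, hw, fun ρ hρ hp => ?_⟩
  have h1 := hmin ((⟨reflection ρ, hρ.1⟩ * w : weylGroup r) • x) ⟨_, fun y hy => ?_, rfl⟩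
  · rw [mul_smul, coe_smul_line] at h1
    change height (w • x).1 ≤ height (reflection ρ (w • x).1) at h1
    rw [reflection_apply, height, height, map_add, map_smul, smul_eq_mul, le_add_iff_nonneg_right]
      at h1
    exact nonneg_of_mul_nonneg_left h1 hρ.2
  · rw [mul_smul, hw y hy]
    refine Subtype.ext ?_
    change reflection ρ y.1 = y.1
    rw [reflection_apply, hp y hy, zero_smul, add_zero]

/-- A property of lists of lines that is invariant under rearrangement and under the Weyl group,
and that holds for the lists fixed by some reflection. -/
structure IsReflectionTrivial (Z : List (Line r) → Prop) : Prop where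
  perm : ∀ {s t}, List.Perm s t → Z s → Z t
  smul : ∀ (w : weylGroup r) {t}, Z (t.map (w • ·)) → Z t
  of_orthogonal : ∀ (ρ : Root r) {t}, IsPosRoot ρ → (∀ x ∈ t, pairing r x.1 ρ.1 = 0) → Z t

namespace Code

/-- The bit that stands for the line `x` in the masks. -/
def Table.pos (c : Table) (x : Line r) : ℕ := 9 * c.lines.idxOf (code x.1) + 64

/-- The table `c` contains all lines on `X_r`, and the masks computed from it are correct. The
number of lines is limited by the number of bits that `bits` reads. -/
structure Table.Valid (c : Table) (r : ℕ) : Prop where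
  mem : ∀ x : Line r, code x.1 ∈ c.lines
  length_le : c.lines.length ≤ 400
  short : ∀ x : Line r, short (code x.1)
  testBit_ones : ∀ x : Line r, (mask c.ones).testBit (c.pos x)
  testBit_geMask : ∀ v : Pic r, Code.short (code v) → ∀ n ≤ 3, ∀ x : Line r,
    (c.geMask (pair (code v) c.columns) n).testBit (c.pos x) ↔ (n : ℤ) ≤ pairing r v x.1

theorem exists_table (h4 : 4 ≤ r) (h8 : r ≤ 8) :
    ∃ c : Table, (∀ {α : Type} (k : Table → α), withTable r k = k c) ∧ c.Valid r := by
  obtain ⟨X, hX, hX'⟩ := columns_eq (r := r) fun c => length_of_mem_lines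
  have hb := bounded_eq_true h4 h8
  simp only [bounded, Bool.and_eq_true, List.all_eq_true, Nat.ble_eq] at hb
  refine ⟨⟨lines r, code X, ones (lines r).length⟩, fun k => by simp [withTable, hX], ?_⟩
  refine ⟨code_mem_lines h8, hb.2, fun x => (hb.1.1 _ (code_mem_lines h8 x)).2, fun x => ?_,
    fun v hv n hn x => ?_⟩
  · have hx := List.idxOf_lt_length_of_mem (code_mem_lines h8 x)
    rw [Table.pos, testBit_mask, ones_eq, ← add_zero (9 * _), testBit_packed (by simp)
      (by simpa using hx) (by norm_num)]
    simp
  · have hx := List.idxOf_lt_length_of_mem (code_mem_lines h8 x)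
    have hl : ∀ a ∈ (lines r).map (pair (code v)), |a| ≤ 250 := by
      intro a ha
      obtain ⟨d, hd, rfl⟩ := List.mem_map.1 ha
      obtain ⟨y, rfl⟩ := exists_code_eq (length_of_mem_lines hd)
      rw [pair_code]
      exact abs_pairing_le hv (hb.1.1 _ hd).1
    rw [Table.pos, pair_code, hX', testBit_geMask hl (by simp) hn (by simpa using hx),
      decide_eq_true_iff]
    simp [pair_code]

/-- The pair of masks `m` records the signs of the pairings of all lines with some positive root
orthogonal to `p`. -/
def Table.IsRootMask (c : Table) (p : List (Line r)) (m : ℕ × ℕ) : Prop :=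
  ∃ ρ : Root r, IsPosRoot ρ ∧ (∀ x ∈ p, pairing r x.1 ρ.1 = 0) ∧
    (∀ x : Line r, m.1.testBit (c.pos x) ↔ pairing r x.1 ρ.1 < 0) ∧
    ∀ x : Line r, m.2.testBit (c.pos x) ↔ pairing r x.1 ρ.1 = 0

variable {c : Table}

theorem Table.testBit_inter (a b : ℕ) (x : Line r) : (inter a b).testBit (c.pos x) =
    (a.testBit (c.pos x) && b.testBit (c.pos x)) := Code.testBit_inter _ _ _

theorem Table.testBit_diff (a b : ℕ) (x : Line r) : (diff a b).testBit (c.pos x) =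
    (a.testBit (c.pos x) && !b.testBit (c.pos x)) := Code.testBit_diff _ _ _

theorem Table.testBit_union (a b : ℕ) (x : Line r) : (union a b).testBit (c.pos x) =
    (a.testBit (c.pos x) || b.testBit (c.pos x)) := Code.testBit_union _ _ _

theorem Table.Valid.rootMasks_eq (hc : c.Valid r) {l : List Code}
    (hl : ∀ d ∈ l, Code.short d ∧ ∃ ρ : Root r, code ρ.1 = d ∧ IsPosRoot ρ) :
    ∃ Φ, (∀ {α : Type} (k : List (ℕ × ℕ) → α), c.rootMasks l k = k Φ) ∧
      ∀ m ∈ Φ, c.IsRootMask (r := r) [] m := by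
  induction l with
  | nil => exact ⟨[], fun _ => rfl, by simp⟩
  | cons d l ih =>
    obtain ⟨Φ, hΦ, hΦ'⟩ := ih fun e he => hl e (by simp [he])
    obtain ⟨hd, ρ, rfl, hρ⟩ := hl _ List.mem_cons_self
    let P := pair (code ρ.1) c.columns
    refine ⟨(Code.diff (mask c.ones) (c.geMask P 0), Code.diff (c.geMask P 0) (c.geMask P 1)) :: Φ,
      fun k => ?_, ?_⟩
    · simp only [Table.rootMasks, forceInt_eq, force_eq, hΦ]
      rfl
    · intro m hm
      rcases List.mem_cons.1 hm with rfl | hm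
      · refine ⟨ρ, hρ, by simp, fun x => ?_, fun x => ?_⟩
        · have h0 := hc.testBit_geMask ρ.1 hd 0 (by norm_num) x
          have h1 := hc.testBit_ones x
          rw [Table.testBit_diff, h1, Bool.true_and, Bool.not_eq_true', ← Bool.not_eq_true, h0,
            pairing_comm]
          simp
        · have h0 := hc.testBit_geMask ρ.1 hd 0 (by norm_num) x
          have h1 := hc.testBit_geMask ρ.1 hd 1 (by norm_num) x
          rw [Table.testBit_diff, Bool.and_eq_true, Bool.not_eq_true', ← Bool.not_eq_true, h0, h1,
            pairing_comm]
          push_cast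
          omega
      · exact hΦ' m hm

theorem orthogonal_eq {α : Type} (b : ℕ) (Φ : List (ℕ × ℕ)) (k : List (ℕ × ℕ) → α) :
    orthogonal b Φ k = k (Φ.filter fun m => m.2.testBit b) := by
  induction Φ generalizing k with
  | nil => rfl
  | cons m Φ ih =>
    have h1 : orthogonal b (m :: Φ) k = Nat.casesOn (motive := fun _ => α)
        (Nat.land (Nat.shiftRight m.2 b) 1)
        (orthogonal b Φ k) fun _ => orthogonal b Φ fun Φ => k (m :: Φ) := rfl
    have h2 : Nat.land (Nat.shiftRight m.2 b) 1 = (m.2.testBit b).toNat := by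
      change (m.2 >>> b) &&& 1 = _
      rw [Nat.and_one_is_mod, Nat.testBit, Nat.and_comm, Nat.and_one_is_mod]
      rcases Nat.mod_two_eq_zero_or_one (m.2 >>> b) with h | h <;> simp [h]
    rw [h1, h2, ih, ih]
    cases h : m.2.testBit b <;> simp [h]

theorem Table.IsRootMask.of_mem_orthogonal {p : List (Line r)} {Φ : List (ℕ × ℕ)}
    (hΦ : ∀ m ∈ Φ, c.IsRootMask p m) (x : Line r) :
    ∀ m ∈ Φ.filter (fun m => m.2.testBit (c.pos x)), c.IsRootMask (x :: p) m := by
  intro m hm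
  obtain ⟨hm, hx⟩ := List.mem_filter.1 hm
  obtain ⟨ρ, h1, h2, h3, h4⟩ := hΦ m hm
  refine ⟨ρ, h1, ?_, h3, h4⟩
  simpa [(h4 x).1 hx] using h2

/-- The set of lines with mask `B` is stable under the pointwise stabilizer of `p`. -/
def Table.Stable (c : Table) (p : List (Line r)) (B : ℕ) : Prop :=
  ∀ w : weylGroup r, (∀ y ∈ p, w • y = y) →
    ∀ x : Line r, B.testBit (c.pos (w • x)) = B.testBit (c.pos x)

theorem Table.Stable.cons {p : List (Line r)} {B : ℕ} (hB : c.Stable p B) (x : Line r) :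
    c.Stable (x :: p) B := fun w hw =>
  hB w fun y hy => hw y (List.mem_cons_of_mem _ hy)

theorem Table.Stable.inter {p : List (Line r)} {A B : ℕ} (hA : c.Stable p A) (hB : c.Stable p B) :
    c.Stable p (inter A B) := fun w hw x => by
  rw [Table.testBit_inter, Table.testBit_inter, hA w hw, hB w hw]

theorem Table.Stable.diff {p : List (Line r)} {A B : ℕ} (hA : c.Stable p A) (hB : c.Stable p B) :
    c.Stable p (diff A B) := fun w hw x => by
  rw [Table.testBit_diff, Table.testBit_diff, hA w hw, hB w hw]

theorem Table.Stable.union {p : List (Line r)} {A B : ℕ} (hA : c.Stable p A) (hB : c.Stable p B) :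
    c.Stable p (union A B) := fun w hw x => by
  rw [Table.testBit_union, Table.testBit_union, hA w hw, hB w hw]

theorem Table.Valid.stable_geMask (hc : c.Valid r) (v : Line r) (p : List (Line r)) {n : ℕ}
    (hn : n ≤ 3) : c.Stable (v :: p) (c.geMask (pair (code v.1) c.columns) n) := fun w hw x => by
  rw [Bool.eq_iff_iff, hc.testBit_geMask _ (hc.short v) n hn, hc.testBit_geMask _ (hc.short v) n hn]
  conv_lhs => rw [← hw v (by simp), coe_smul_line, coe_smul_line, (weylGroup_preserves w.2).2]

theorem mem_split {g C x : ℕ} {k : ℕ → List ℕ} (hx : x ∈ split g C k) :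
    x = inter C g ∨ x ∈ k (diff C (inter C g)) := by
  rw [split] at hx
  simp only [force_eq] at hx
  cases h : inter C g with
  | zero => rw [h] at hx; exact Or.inr hx
  | succ n => rw [h] at hx; exact List.mem_cons.1 hx

theorem Table.exists_mem_split {g C : ℕ} {k : ℕ → List ℕ} {x : Line r}
    (hx : C.testBit (c.pos x))
    (hk : ∀ D : ℕ, D.testBit (c.pos x) → ∃ A ∈ k D, A.testBit (c.pos x)) :
    ∃ A ∈ split g C k, A.testBit (c.pos x) := by
  have hD := c.testBit_inter C g x
  have hR := c.testBit_diff C (Code.inter C g) x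
  rw [split]
  simp only [force_eq]
  cases h : Code.inter C g with
  | zero =>
    rw [h, hx] at hR
    exact hk _ (by simpa using hR)
  | succ n =>
    by_cases hg : g.testBit (c.pos x)
    · exact ⟨n + 1, List.mem_cons_self, by rw [← h, hD, hx, hg]; rfl⟩
    · obtain ⟨A, hA, hA'⟩ := hk (Code.diff C (Code.inter C g)) (by rw [hR, hD, hx]; simp [hg])
      exact ⟨A, List.mem_cons_of_mem _ (h ▸ hA), hA'⟩

theorem Table.Valid.stable_of_mem_refine (hc : c.Valid r) {p : List (Line r)} (v : Line r)
    {Bs : List ℕ} (hBs : ∀ B ∈ Bs, c.Stable p B) :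
    ∀ B ∈ c.refine (code v.1) Bs, c.Stable (v :: p) B := by
  intro B hB
  simp only [Table.refine, forceInt_eq, force_eq, List.mem_flatMap] at hB
  obtain ⟨C, hC, hB⟩ := hB
  have hC := (hBs C hC).cons v
  have h0 := hc.stable_geMask v p (n := 0) (by norm_num)
  have h1 := hc.stable_geMask v p (n := 1) (by norm_num)
  have h2 := hc.stable_geMask v p (n := 2) (by norm_num)
  have h3 := hc.stable_geMask v p (n := 3) (by norm_num)
  have step (g C : ℕ) (k : ℕ → List ℕ) (hg : c.Stable (v :: p) g) (hC : c.Stable (v :: p) C)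
      (hk : ∀ D, c.Stable (v :: p) D → ∀ A ∈ k D, c.Stable (v :: p) A) :
      ∀ A ∈ split g C k, c.Stable (v :: p) A := by
    intro A hA
    rcases mem_split hA with rfl | hA
    · exact hC.inter hg
    · exact hk _ (hC.diff (hC.inter hg)) A hA
  refine step _ _ _ (h0.diff h1) hC (fun D hD => ?_) B hB
  refine step _ _ _ (h2.diff h3) hD fun D hD => ?_
  refine step _ _ _ h1 hD fun D hD A hA => ?_
  cases D with
  | zero => simp at hA
  | succ D => rwa [List.mem_singleton.1 hA]

theorem Table.exists_mem_refine (v : Code) {Bs : List ℕ} {x : Line r} {B : ℕ} (hB : B ∈ Bs)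
    (hx : B.testBit (c.pos x)) : ∃ C ∈ c.refine v Bs, C.testBit (c.pos x) := by
  simp only [Table.refine, forceInt_eq, force_eq, List.mem_flatMap]
  have key : ∀ g e f : ℕ, ∃ C ∈ split g B fun C => split e C fun C => split f C fun C =>
      Nat.casesOn C [] fun C' => [Nat.succ C'], C.testBit (c.pos x) := by
    intro g e f
    refine c.exists_mem_split hx fun D hD => c.exists_mem_split hD fun D hD =>
      c.exists_mem_split hD fun D hD => ?_
    cases D with
    | zero => simp at hD
    | succ D => exact ⟨D + 1, by simp, hD⟩
  obtain ⟨C, hC, hC'⟩ := key _ _ _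
  exact ⟨C, ⟨B, hB, hC⟩, hC'⟩

theorem mem_extend {f : ℕ → List ℕ → List (List Code)} {m : ℕ} {L : List (ℕ × List ℕ)}
    {B : ℕ × List ℕ} (hB : B ∈ L) {b : ℕ} (hb : b ∈ bits (diff B.1 m)) {s : List Code}
    (hs : s ∈ f b B.2) : s ∈ extend f m L := by
  induction L with
  | nil => simp at hB
  | cons A L ih =>
    rw [extend, List.mem_append]
    rcases List.mem_cons.1 hB with rfl | hB
    · exact Or.inl (List.mem_flatMap.2 ⟨b, hb, hs⟩)
    · exact Or.inr (ih hB)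

/-- Whatever nonempty list `q` is covered by the blocks `Bs`, some `(B, Cs)` in `L` is such that
`B` contains a member of `q` and `Cs` covers `q`. -/
def Table.Branches (c : Table) (p : List (Line r)) (Bs : List ℕ) (L : List (ℕ × List ℕ)) : Prop :=
  ∀ q : List (Line r), q ≠ [] → (∀ x ∈ q, ∃ B ∈ Bs, B.testBit (c.pos x)) →
    ∃ B ∈ L, c.Stable p B.1 ∧ (∀ C ∈ B.2, c.Stable p C) ∧ (∃ x ∈ q, B.1.testBit (c.pos x)) ∧
      ∀ x ∈ q, ∃ C ∈ B.2, C.testBit (c.pos x)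

theorem Table.branches_tails {p : List (Line r)} {Bs : List ℕ} (hBs : ∀ B ∈ Bs, c.Stable p B) :
    c.Branches p Bs (tails Bs) := by
  induction Bs with
  | nil =>
    intro q hq h
    obtain ⟨x, hx⟩ := List.exists_mem_of_ne_nil q hq
    simpa using h x hx
  | cons A Bs ih =>
    intro q hq h
    by_cases hA : ∃ x ∈ q, A.testBit (c.pos x)
    · exact ⟨(A, A :: Bs), List.mem_cons_self, hBs A List.mem_cons_self, hBs, hA, h⟩
    · push Not at hA
      obtain ⟨B, hB, h'⟩ := ih (fun B hB => hBs B (List.mem_cons_of_mem _ hB)) q hq fun x hx => by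
        obtain ⟨B, hB, hxB⟩ := h x hx
        rcases List.mem_cons.1 hB with rfl | hB
        · exact absurd hxB (hA x hx)
        · exact ⟨B, hB, hxB⟩
      exact ⟨B, List.mem_cons_of_mem _ hB, h'⟩

theorem Table.unions_eq {p : List (Line r)} {Bs : List ℕ} (hBs : ∀ B ∈ Bs, c.Stable p B) :
    ∃ L U, (∀ k, unions Bs k = k L U) ∧ c.Branches p Bs L ∧ c.Stable p U ∧
      ∀ x : Line r, (∃ B ∈ Bs, B.testBit (c.pos x)) → U.testBit (c.pos x) := by
  induction Bs with
  | nil =>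
    refine ⟨[], 0, fun _ => rfl, fun q hq h => ?_,
      fun w _ x => by rw [Nat.zero_testBit, Nat.zero_testBit], by simp⟩
    obtain ⟨x, hx⟩ := List.exists_mem_of_ne_nil q hq
    simpa using h x hx
  | cons A Bs ih =>
    obtain ⟨L, U, hk, hL, hU, hU'⟩ := ih fun B hB => hBs B (List.mem_cons_of_mem _ hB)
    have hunion : ∀ x : Line r, (∃ B ∈ A :: Bs, B.testBit (c.pos x)) →
        (Code.union A U).testBit (c.pos x) := by
      rintro x ⟨B, hB, hx⟩
      rw [Table.testBit_union]
      rcases List.mem_cons.1 hB with rfl | hB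
      · simp [hx]
      · simp [hU' x ⟨B, hB, hx⟩]
    have hst := (hBs A List.mem_cons_self).union hU
    refine ⟨(A, [Code.union A U]) :: L, Code.union A U, fun k => by simp [unions, hk], ?_, hst,
      hunion⟩
    intro q hq h
    by_cases hA : ∃ x ∈ q, A.testBit (c.pos x)
    · exact ⟨_, List.mem_cons_self, hBs A List.mem_cons_self, by simpa using hst, hA,
        fun x hx => ⟨_, by simp, hunion x (h x hx)⟩⟩
    · push Not at hA
      obtain ⟨B, hB, h'⟩ := hL q hq fun x hx => by
        obtain ⟨B, hB, hxB⟩ := h x hx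
        rcases List.mem_cons.1 hB with rfl | hB
        · exact absurd hxB (hA x hx)
        · exact ⟨B, hB, hxB⟩
      exact ⟨B, List.mem_cons_of_mem _ hB, h'⟩

theorem Table.Valid.lineAt_pos (hc : c.Valid r) (x : Line r) : c.lineAt (c.pos x) = code x.1 := by
  have := List.idxOf_lt_length_of_mem (hc.mem x)
  rw [Table.lineAt, Table.pos, Nat.add_sub_cancel, Nat.mul_div_cancel_left _ (by norm_num),
    List.getD_eq_getElem _ _ this, List.getElem_idxOf this]

theorem Table.Valid.mem_bits (hc : c.Valid r) {m : ℕ} {x : Line r} (h : m.testBit (c.pos x)) :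
    c.pos x ∈ bits m := by
  have := List.idxOf_lt_length_of_mem (hc.mem x)
  have := hc.length_le
  exact Code.mem_bits (by omega) h

/-- To prove that a reflection-trivial property holds for `q ++ p`, a chosen member `x` of `q` may
be assumed to be dominant for the roots orthogonal to `p`, and put in front of `p`. -/
theorem _root_.Pic.IsReflectionTrivial.of_smul_head [Finite (Line r)] {Z : List (Line r) → Prop}
    (hZ : IsReflectionTrivial Z) (p : List (Line r)) {q : List (Line r)} {x : Line r}
    (hx : x ∈ q) :
    ∃ (w : weylGroup r) (q' : List (Line r)), (∀ y ∈ p, w • y = y) ∧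
      (∀ ρ : Root r, IsPosRoot ρ → (∀ y ∈ p, pairing r y.1 ρ.1 = 0) →
        0 ≤ pairing r (w • x).1 ρ.1) ∧ q'.length + 1 = q.length ∧ (∀ y ∈ q', y ∈ q) ∧
      (Z (q'.map (w • ·) ++ (w • x) :: p) → Z (q ++ p)) := by
  classical
  obtain ⟨w, hw, hw'⟩ := exists_dominant p x
  have hperm := List.perm_cons_erase hx
  refine ⟨w, q.erase x, hw, hw', by rw [hperm.length_eq]; rfl, fun y => List.mem_of_mem_erase,
    fun h => hZ.smul w ?_⟩
  refine hZ.perm ?_ h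
  rw [List.map_append, List.map_congr_left (l := p) (g := id) hw, List.map_id]
  refine List.perm_middle.trans ?_
  exact (List.Perm.append_right p (hperm.map (w • ·))).symm

/-- The inductive step of `Table.Valid.of_search`, for both ways `f` of passing the blocks on to
the next step. -/
theorem Table.Valid.of_extend (hc : c.Valid r) [Finite (Line r)] {Z : List (Line r) → Prop}
    (hZ : IsReflectionTrivial Z) {n : ℕ} {p : List (Line r)} {Φ : List (ℕ × ℕ)}
    (hΦ : ∀ m ∈ Φ, c.IsRootMask p m) {Bs : List ℕ} {L : List (ℕ × List ℕ)}
    (hL : c.Branches p Bs L) {f : Code → List ℕ → List ℕ}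
    (hf : ∀ (x : Line r) (Cs : List ℕ), (∀ C ∈ Cs, c.Stable p C) →
      (∀ C ∈ f (code x.1) Cs, c.Stable (x :: p) C) ∧
      ∀ y : Line r, (∃ C ∈ Cs, C.testBit (c.pos y)) →
        ∃ C ∈ f (code x.1) Cs, C.testBit (c.pos y))
    (ih : ∀ (p : List (Line r)) (Φ : List (ℕ × ℕ)) (Bs : List ℕ), (∀ m ∈ Φ, c.IsRootMask p m) →
      (∀ B ∈ Bs, c.Stable p B) →
      (∀ t : List (Line r), t.map (fun x => code x.1) ∈
        c.search n (p.map fun x => code x.1) Φ Bs → Z t) →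
      ∀ q : List (Line r), q.length = n + 1 → (∀ x ∈ q, ∃ B ∈ Bs, B.testBit (c.pos x)) →
        Z (q ++ p))
    (hs : ∀ t : List (Line r), t.map (fun x => code x.1) ∈
      extend (fun b Cs => orthogonal b Φ fun Φ =>
        c.search n (c.lineAt b :: p.map fun x => code x.1) Φ (f (c.lineAt b) Cs))
        (mask (Nat.shiftRight (bad Prod.fst Φ) 64)) L → Z t)
    {q : List (Line r)} (hq : q.length = n + 1 + 1)
    (hcov : ∀ x ∈ q, ∃ B ∈ Bs, B.testBit (c.pos x)) : Z (q ++ p) := by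
  obtain ⟨B, hBL, hBst, hst, ⟨x, hx, hxB⟩, hCs⟩ := hL q (by rintro rfl; simp at hq) hcov
  obtain ⟨w, q', hw, hdom, hlen, hq', hgoal⟩ := hZ.of_smul_head p hx
  refine hgoal ?_
  have hf' := hf (w • x) B.2 hst
  refine ih ((w • x) :: p) _ (f (code (w • x).1) B.2) (Table.IsRootMask.of_mem_orthogonal hΦ _)
    hf'.1 (fun t ht => hs t ?_) _ (by rw [List.length_map]; omega) fun y hy => ?_
  · have hpos : B.1.testBit (c.pos (w • x)) := by rwa [hBst w hw]
    have hbad : (mask (Nat.shiftRight (bad Prod.fst Φ) 64)).testBit (c.pos (w • x)) = false := by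
      rw [Table.pos, testBit_mask]
      change (bad Prod.fst Φ >>> 64).testBit _ = _
      rw [Nat.testBit_shiftRight, add_comm, ← Table.pos, ← Bool.not_eq_true, testBit_bad]
      rintro ⟨m, hm, hmx⟩
      obtain ⟨ρ, h1, h2, h3, -⟩ := hΦ m hm
      exact absurd ((h3 _).1 hmx) (not_lt.2 (hdom ρ h1 h2))
    refine mem_extend hBL (hc.mem_bits (x := w • x) ?_) ?_
    · rw [Table.testBit_diff, hpos, hbad]; rfl
    · rw [orthogonal_eq, hc.lineAt_pos]
      exact ht
  · obtain ⟨z, hz, rfl⟩ := List.mem_map.1 hy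
    obtain ⟨C, hC, hzC⟩ := hCs z (hq' z hz)
    exact hf'.2 _ ⟨C, hC, by rwa [hst C hC w hw]⟩

/-- The search is exhaustive: a property of lists of lines that is invariant under rearrangement
and under the Weyl group and holds for lists fixed by a reflection holds for all lists extending
`p` as soon as it holds for the lists that the search returns. -/
theorem Table.Valid.of_search (hc : c.Valid r) [Finite (Line r)] {Z : List (Line r) → Prop}
    (hZ : IsReflectionTrivial Z) (n : ℕ) (p : List (Line r)) (Φ : List (ℕ × ℕ)) (Bs : List ℕ)
    (hΦ : ∀ m ∈ Φ, c.IsRootMask p m) (hBs : ∀ B ∈ Bs, c.Stable p B)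
    (hs : ∀ t : List (Line r), t.map (fun x => code x.1) ∈
      c.search n (p.map fun x => code x.1) Φ Bs → Z t)
    (q : List (Line r)) (hq : q.length = n + 1)
    (hcov : ∀ x ∈ q, ∃ B ∈ Bs, B.testBit (c.pos x)) : Z (q ++ p) := by
  induction n generalizing p Φ Bs q with
  | zero =>
    -- a dominant last line is orthogonal to a root in `Φ`, or it is found by the search
    obtain ⟨x, rfl⟩ := List.length_eq_one_iff.1 hq
    obtain ⟨B, hB, hxB⟩ := hcov x (by simp)
    obtain ⟨w, q', hw, hdom, hlen, -, hgoal⟩ := hZ.of_smul_head p (List.mem_singleton_self x)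
    obtain rfl : q' = [] := List.length_eq_zero_iff.1 (by simpa using hlen)
    refine hgoal ?_
    by_cases hbad : (bad (fun ρ => Nat.lor ρ.1 ρ.2) Φ).testBit (c.pos (w • x))
    · rw [testBit_bad] at hbad
      obtain ⟨m, hm, hmx⟩ := hbad
      obtain ⟨ρ, h1, h2, h3, h4⟩ := hΦ m hm
      change (m.1 ||| m.2).testBit _ = true at hmx
      rw [Nat.testBit_lor, Bool.or_eq_true, h3, h4] at hmx
      refine hZ.of_orthogonal ρ h1 ?_
      rcases hmx with hmx | hmx
      · exact absurd hmx (not_lt.2 (hdom ρ h1 h2))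
      · simpa [hmx] using h2
    · refine hs _ (List.mem_map.2 ⟨c.pos (w • x), hc.mem_bits ?_, by rw [hc.lineAt_pos]; rfl⟩)
      have hor : (Bs.foldr Nat.lor 0).testBit (c.pos (w • x)) := by
        have hwB : B.testBit (c.pos (w • x)) := by rwa [hBs B hB w hw]
        clear hcov hBs hs
        induction Bs with
        | nil => simp at hB
        | cons A Bs ih =>
          change (A ||| Bs.foldr Nat.lor 0).testBit _ = true
          rw [Nat.testBit_lor]
          rcases List.mem_cons.1 hB with rfl | hB
          · simp [hwB]
          · simp [ih hB]
      rw [Table.testBit_diff, hor]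
      simpa using hbad
  | succ n ih =>
    rw [Table.search] at hs
    simp only [force_eq] at hs
    cases n with
    | zero =>
      obtain ⟨L, U, hk, hL, -, -⟩ := c.unions_eq hBs
      simp only [hk] at hs
      exact hc.of_extend hZ hΦ hL (f := fun _ Cs => Cs)
        (fun x Cs hCs => ⟨fun C hC => (hCs C hC).cons x, fun y hy => hy⟩) ih hs hq hcov
    | succ n =>
      exact hc.of_extend hZ hΦ (c.branches_tails hBs) (f := c.refine)
        (fun x Cs hCs => ⟨hc.stable_of_mem_refine x hCs,
          fun y ⟨C, hC, hy⟩ => c.exists_mem_refine _ hC hy⟩) ih hs hq hcov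

/-! ### Certificates for the survivors on `X₈` -/

/-- The simultaneous application of the reflections in `ρs`, the first one first. -/
def applyWord : List Code → List Code → List Code
  | [], t => t
  | ρ :: ρs, t => forceCodes (t.map fun x => reflect x ρ) (applyWord ρs)

/-- The roots with the given indices. -/
def select (R : List Code) (w : List ℕ) : List Code := w.filterMap (R[·]?)

/-- The sets of six lines on `X₈`, up to the Weyl group, whose twisted sums do not vanish. They are
chosen within their orbits such that each `ℓᵢ` is determined by its pairings with them, see
`isolated_l`. -/
def representatives : List (List Code) := [
  [[0, 1, 0, 0, 0, 0, 0, 0, 0],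
   [1, -1, -1, 0, 0, 0, 0, 0, 0],
   [1, -1, 0, -1, 0, 0, 0, 0, 0],
   [1, 0, 0, 0, 0, -1, 0, 0, -1],
   [2, 0, -1, -1, 0, -1, -1, 0, -1],
   [3, -1, -1, -1, -2, -1, -1, -1, 0]],
  [[0, 1, 0, 0, 0, 0, 0, 0, 0],
   [1, 0, 0, 0, 0, -1, 0, 0, -1],
   [2, -1, -1, -1, -1, -1, 0, 0, 0],
   [2, -1, -1, 0, 0, 0, -1, -1, -1],
   [2, -1, 0, -1, -1, 0, -1, -1, 0],
   [2, 0, -1, -1, 0, -1, -1, 0, -1]],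
  [[0, 0, 1, 0, 0, 0, 0, 0, 0],
   [1, 0, -1, -1, 0, 0, 0, 0, 0],
   [1, 0, -1, 0, 0, 0, 0, 0, -1],
   [1, 0, 0, 0, -1, -1, 0, 0, 0],
   [1, 0, 0, 0, -1, 0, -1, 0, 0],
   [3, -2, -1, -1, -1, -1, -1, -1, 0]],
  [[0, 0, 0, 0, 1, 0, 0, 0, 0],
   [1, -1, 0, 0, 0, 0, 0, -1, 0],
   [1, 0, -1, 0, 0, 0, 0, -1, 0],
   [1, 0, 0, 0, -1, -1, 0, 0, 0],
   [1, 0, 0, 0, -1, 0, -1, 0, 0],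
   [4, -2, -2, -2, -1, -1, -1, -1, -1]],
  [[1, -1, -1, 0, 0, 0, 0, 0, 0],
   [1, 0, 0, -1, -1, 0, 0, 0, 0],
   [1, 0, 0, 0, 0, 0, 0, -1, -1],
   [2, -1, 0, -1, 0, 0, -1, -1, -1],
   [2, 0, 0, -1, -1, -1, -1, -1, 0],
   [3, -1, -1, -1, -1, -2, -1, 0, -1]]]

/-- The certificates for `survivors 8`, in the same order: `(0, w)` if the twisted sum vanishes,
and `(n + 1, w)` if the survivor is equivalent to the representative with index `n`. Here `w` is
the list of the indices in `roots 8` of the reflections to be applied. -/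
def certificates : List (ℕ × List ℕ) := [
  (0, [0, 1]), (0, [25, 26]), (0, [25, 26]), (0, [33, 34]), (0, [33, 34]), (0, [1, 4]),
  (0, [1, 4]), (1, [12, 13, 16, 35, 51, 72]), (2, [4, 6, 8, 40, 55, 86]),
  (1, [0, 1, 13, 15, 24, 55, 86]), (2, [4, 8, 40, 55, 86]), (0, [0, 1]), (0, [41, 42]),
  (0, [41, 42]), (0, [1, 4]), (1, [1, 10, 13, 30, 44, 49]), (2, [0, 4, 8, 44, 49, 108]),
  (0, [0, 1]), (0, [1, 4]), (0, [0, 1]), (0, [37, 39, 41, 95]), (0, [1, 3]), (0, [8, 10]),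
  (3, [2, 13, 16, 42, 62]), (3, [13, 16, 42, 62]), (4, [3, 12, 18, 33, 40, 71]),
  (3, [3, 15, 21, 34, 62]), (0, [16, 29]), (4, [2, 17, 20, 35, 47, 57]), (0, [1, 3]), (0, [0, 5]),
  (0, [22, 24]), (0, [22, 24]), (0, [33, 34]), (0, [33, 34]), (0, [0, 5]), (0, [2, 5]),
  (0, [33, 34]), (0, [33, 34]), (0, [7, 22, 24]), (0, [7, 22, 24]), (0, [0, 5]),
  (0, [58, 59, 71]), (0, [58, 59, 71]), (0, [2, 5]), (0, [2, 5]), (0, [0, 5]), (0, [33, 34]),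
  (0, [3, 5]), (0, [11, 12]), (0, [33, 34]), (0, [33, 34]), (0, [33, 34]), (0, [33, 34]),
  (0, [19, 29]), (0, [33, 34]), (0, [3, 5]), (0, [0, 5]), (0, [22, 24]), (0, [22, 24]),
  (0, [65, 90, 91]), (0, [65, 90, 91]), (0, [2, 5]), (0, [66, 67]), (0, [66, 67]), (0, [0, 5]),
  (0, [57, 90, 91]), (0, [57, 90, 91]), (0, [2, 5]), (0, [2, 5]), (0, [0, 5]),
  (4, [8, 9, 10, 13, 14, 62]), (0, [3, 5]), (0, [11, 12]), (5, [1, 3, 23, 26, 49, 70, 71]),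
  (5, [3, 17, 24, 26, 27, 65, 83]), (0, [32, 59, 61, 83]), (5, [1, 4, 12, 18, 27, 65, 83]),
  (0, [19, 29]), (0, [1, 69, 72, 105]), (0, [3, 5]), (0, [0, 1]), (0, [25, 26]), (0, [25, 26]),
  (0, [66, 67, 71]), (0, [66, 67, 71]), (0, [1, 4]), (0, [7, 25, 26]), (0, [7, 25, 26]),
  (0, [0, 1]), (0, [1, 4]), (0, [0, 1]), (3, [0, 1, 13, 25, 28, 30, 61]), (0, [1, 3]),
  (0, [8, 10]), (0, [33, 37, 48, 95]), (0, [37, 39, 41, 95]), (5, [0, 14, 18, 32, 44, 58]),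
  (0, [12, 40, 72, 104]), (0, [16, 29]), (5, [4, 13, 14, 32, 43, 92]), (0, [1, 3]), (0, [0, 5]),
  (0, [22, 24]), (0, [22, 24]), (0, [2, 5]), (0, [41, 42]), (0, [41, 42]), (0, [2, 5]),
  (0, [0, 5]), (0, [41, 42]), (0, [3, 5]), (0, [11, 12]), (0, [41, 42]), (0, [41, 42]),
  (0, [41, 42]), (0, [41, 42]), (0, [19, 29]), (0, [41, 42]), (0, [3, 5]), (0, [0, 1]),
  (0, [25, 26]), (0, [25, 26]), (0, [1, 4]), (0, [0, 1]), (3, [1, 9, 11, 25, 27, 55]),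
  (0, [1, 3]), (0, [8, 10]), (0, [37, 39, 41, 95]), (0, [33, 37, 48, 95]),
  (5, [0, 6, 7, 18, 32, 44, 58]), (0, [12, 49, 63, 104]), (0, [16, 29]),
  (5, [14, 20, 23, 24, 50, 69]), (0, [1, 3]), (0, [2, 4]), (0, [10, 11]), (0, [15, 17]),
  (1, [0, 4, 6, 25, 30, 48]), (1, [4, 6, 25, 30, 48]), (1, [3, 4, 6, 25, 30, 48]), (0, [1, 5]),
  (0, [0, 1, 5]), (0, [16, 19, 29]), (0, [10, 11]), (0, [10, 11]), (0, [22, 25]),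
  (0, [18, 36, 37]), (0, [23, 36, 37]), (0, [1, 5]), (0, [22, 25, 29]), (0, [0, 2, 4]),
  (0, [2, 4]), (0, [1, 5]), (0, [15, 17]), (0, [2, 4]), (0, [34, 48, 78]), (0, [34, 48, 78]),
  (1, [4, 14, 22, 29, 31, 33]), (0, [43, 44]), (0, [2, 4]), (0, [10, 11]), (0, [23, 36, 37]),
  (0, [22, 23, 25]), (0, [1, 5]), (0, [1, 5]), (0, [36, 37]), (0, [2, 4]), (0, [22, 23, 25]),
  (0, [22, 23, 25]), (0, [52, 65, 90]), (0, [46, 61, 94]), (0, [17, 19, 38]), (0, [15, 16, 38]),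
  (0, [53, 67, 99]), (0, [53, 66, 99]), (0, [1, 5]), (0, [9, 11, 23]), (0, [9, 10, 23]),
  (0, [0, 1]), (0, [25, 26]), (0, [25, 26]), (0, [33, 34]), (0, [33, 34]), (0, [1, 4]),
  (1, [10, 21, 22, 32, 68, 69]), (2, [11, 15, 16, 26, 54, 70]), (0, [1, 4]), (0, [104, 105]),
  (0, [104, 105]), (0, [0, 1]), (0, [1, 4]), (0, [0, 1]), (4, [0, 8, 12, 17, 28, 79, 81]),
  (0, [1, 3]), (0, [8, 10]), (5, [0, 2, 4, 39, 41, 43, 86]), (5, [0, 4, 39, 41, 43, 86]),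
  (0, [26, 27, 76, 106]), (5, [1, 3, 13, 23, 81, 86]), (0, [16, 29]), (0, [37, 39, 41, 95]),
  (0, [1, 3]), (0, [0, 5]), (0, [22, 24]), (0, [22, 24]), (0, [65, 90, 91]), (0, [65, 90, 91]),
  (0, [0, 5]), (0, [65, 66, 67]), (0, [65, 66, 67]), (0, [2, 5]), (0, [2, 5]), (0, [0, 5]),
  (0, [33, 34]), (0, [3, 5]), (0, [11, 12]), (0, [33, 34]), (0, [33, 34]), (0, [33, 34]),
  (0, [33, 34]), (0, [19, 29]), (0, [33, 34]), (0, [3, 5]), (0, [0, 5]), (0, [22, 24]),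
  (0, [22, 24]), (0, [2, 5]), (0, [90, 91]), (0, [90, 91]), (0, [2, 5]), (0, [0, 5]),
  (3, [14, 22, 23, 33, 37, 84]), (0, [3, 5]), (0, [11, 12]), (0, [22, 40, 82, 98]),
  (0, [30, 40, 86, 98]), (5, [0, 1, 5, 7, 15, 33]), (0, [32, 59, 61, 83]), (0, [19, 29]),
  (5, [6, 8, 9, 14, 23, 25, 36]), (0, [3, 5]), (0, [0, 1]), (0, [25, 26]), (0, [25, 26]),
  (0, [1, 4]), (0, [0, 1]), (0, [90, 91]), (0, [1, 3]), (0, [8, 10]), (0, [90, 91]),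
  (0, [90, 91]), (0, [90, 91]), (0, [90, 91]), (0, [16, 29]), (0, [90, 91]), (0, [1, 3]),
  (0, [2, 4]), (0, [10, 11]), (0, [15, 17]), (2, [4, 12, 18, 33, 71, 73]),
  (2, [3, 6, 11, 25, 30, 81]), (2, [6, 11, 25, 30, 81]), (0, [1, 5]), (0, [0, 1, 5]),
  (0, [16, 19, 29]), (0, [10, 11]), (0, [10, 11]), (0, [22, 25]), (0, [18, 36, 37]),
  (0, [23, 36, 37]), (0, [1, 5]), (0, [22, 25, 29]), (0, [0, 2, 4]), (0, [2, 4]), (0, [1, 5]),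
  (0, [15, 17]), (0, [2, 4]), (0, [65, 66, 67]), (0, [65, 66, 67]), (2, [1, 4, 14, 15, 33, 68]),
  (0, [43, 44]), (0, [2, 4]), (0, [10, 11]), (0, [23, 36, 37]), (0, [22, 23, 25]), (0, [1, 5]),
  (0, [1, 5]), (0, [36, 37]), (0, [2, 4]), (0, [13, 85, 94]), (0, [13, 85, 94]),
  (0, [42, 61, 89]), (0, [35, 72, 85]), (0, [17, 19, 38]), (0, [15, 16, 38]), (0, [49, 65, 81]),
  (0, [49, 65, 81]), (0, [1, 5]), (0, [9, 11, 23]), (0, [9, 10, 23]), (0, [81, 86]),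
  (0, [81, 87]), (0, [81, 87]), (0, [81, 86]), (0, [81, 87]), (0, [81, 86]), (0, [81, 87]),
  (0, [81, 86]), (0, [83, 86]), (0, [83, 86]), (0, [83, 85]), (0, [83, 86]), (0, [83, 85]),
  (0, [83, 85]), (0, [83, 86]), (0, [83, 86]), (0, [83, 85]), (0, [83, 86]), (0, [83, 85]),
  (0, [83, 85]), (0, [83, 86]), (0, [81, 86]), (0, [81, 87]), (0, [81, 86]), (0, [81, 87]),
  (0, [81, 86]), (0, [83, 86]), (0, [83, 85]), (0, [83, 85]), (0, [83, 86]), (0, [81, 86]),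
  (0, [81, 87]), (0, [81, 86]), (0, [26, 40, 43]), (0, [18, 30, 50]), (0, [20, 77, 90]),
  (0, [17, 76, 90]), (0, [23, 38, 58]), (0, [23, 36, 58]), (0, [0, 6]), (0, [12, 72, 82]),
  (0, [11, 72, 82]), (0, [81, 86]), (0, [81, 87]), (0, [81, 87]), (0, [81, 86]), (0, [81, 87]),
  (0, [81, 86]), (0, [83, 86]), (0, [83, 86]), (0, [83, 85]), (0, [83, 85]), (0, [83, 86]),
  (0, [83, 86]), (0, [83, 85]), (0, [83, 85]), (0, [83, 86]), (0, [81, 86]), (0, [81, 87]),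
  (0, [81, 86]), (0, [30, 48, 106]), (0, [45, 54, 103]), (0, [10, 53, 63]), (0, [2, 47, 68]),
  (0, [40, 42, 100]), (0, [40, 42, 100]), (0, [0, 6]), (0, [12, 72, 82]), (0, [11, 72, 82]),
  (0, [41, 42]), (0, [41, 42]), (0, [41, 42]), (0, [41, 42]), (0, [41, 42]), (0, [41, 42]),
  (0, [41, 42]), (0, [41, 42]), (0, [41, 42]), (0, [41, 42]), (0, [41, 42]), (0, [41, 42]),
  (0, [41, 42]), (0, [41, 42]), (0, [41, 42]), (0, [41, 42]), (0, [41, 42]), (0, [41, 42]),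
  (0, [41, 42]), (0, [41, 42]), (0, [41, 42]), (0, [41, 42]), (0, [41, 42]), (0, [41, 42]),
  (0, [41, 42]), (0, [41, 42]), (0, [41, 42]), (0, [41, 42]), (0, [41, 42]), (0, [41, 42]),
  (0, [41, 42]), (0, [41, 42]), (0, [41, 42]), (0, [11, 20, 26]), (0, [11, 20, 25]), (0, [0, 2]),
  (0, [10, 35, 48]), (0, [9, 35, 48]), (0, [41, 42]), (0, [41, 42]), (0, [41, 42]), (0, [41, 42]),
  (0, [41, 42]), (0, [41, 42]), (0, [41, 42]), (0, [41, 42]), (0, [41, 42]), (0, [41, 42]),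
  (0, [41, 42]), (0, [41, 42]), (0, [41, 42]), (0, [41, 42]), (0, [41, 42]), (0, [41, 42]),
  (0, [41, 42]), (0, [41, 42]), (0, [13, 14, 65]), (0, [13, 14, 65]), (0, [0, 2]),
  (0, [4, 31, 34]), (0, [4, 31, 33]), (0, [22, 24]), (0, [22, 24]), (0, [22, 24]), (0, [22, 24])]

/-- For each representative, words in the reflections that realize the members of the list of all
its pairing-preserving permutations, in the order of `isometries`. -/
def stabilizers : List (List (List ℕ)) := [
  [[], [38], [2], [2, 38]],
  [[], [19, 20, 21], [38], [19, 20, 21, 38]],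
  [[], [5], [36], [5, 36], [5, 45], [45]],
  [[], [5], [1], [1, 5], [46], [5, 46], [1, 46], [1, 5, 46], [1, 53], [1, 5, 53], [53], [5, 53]],
  [[], [31]]]

/-- Whether the word `w` in the roots `R` maps `t` to a rearrangement of itself with the wrong sign
(for a certificate `(0, w)`) or to a rearrangement of the `n`-th representative (for a certificate
`(n + 1, w)`). -/
def certify (R t : List Code) : ℕ × List ℕ → Bool
  | (0, w) => forceCodes (applyWord (select R w) t) fun u =>
    u.permSign t ≠ 0 && u.permSign t ≠ (-1) ^ (select R w).length
  | (n + 1, w) => forceCodes (applyWord (select R w) t) fun u =>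
    match representatives[n]? with
    | none => false
    | some s => u.permSign s ≠ 0

/-- Whether the lists are certified one by one. -/
def certifyAll (R : List Code) : List (List Code) → List (ℕ × List ℕ) → Bool
  | [], _ => true
  | _ :: _, [] => false
  | t :: ts, c :: cs => forceCodes t (fun t => certify R t c) && certifyAll R ts cs

/-- The images of the list `t` under the maps from `t` to `u` that preserve all pairings and that
extend the assignment `A` (a list of pairs of an argument and its value). -/
def isometries : List Code → List Code → List (Code × Code) → List (List Code)
  | [], _, _ => [[]]
  | x :: t, u, A => u.flatMap fun y =>
    if A.all fun z => pair x z.1 = pair y z.2 then (isometries t u ((x, y) :: A)).map (y :: ·)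
    else []

/-- Whether the given words map `t` to the given rearrangements of `t`, with a determinant equal to
the sign of the rearrangement. -/
def realize (R t : List Code) : List (List Code) → List (List ℕ) → Bool
  | [], _ => true
  | _ :: _, [] => false
  | u :: us, w :: ws => applyWord (select R w) t = u &&
    u.permSign t = (-1) ^ (select R w).length && realize R t us ws

/-- Whether the line `e` is alone in its block when the set of all lines is divided into blocks
according to the pairings with the members of `t`. -/
def Table.isolated (c : Table) (t : List Code) (e : Code) : Bool :=
  force (9 * c.lines.idxOf e + 64) fun b =>
    (t.foldr c.refine [mask c.ones]).all fun B => !(bits B).elem b || bits B = [b]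

/-- Whether a coordinate list is that of a line on `X_r`. -/
def isLine (r : ℕ) (c : Code) : Bool :=
  c.length = r + 1 && pair (code (K r)) c = -1 && pair c c = -1

end Code

/-! ### Finiteness of the Weyl group and the signature -/

/-- A Weyl group element is determined by the images of the `ℓᵢ`, because it fixes
`K = -3 h + ∑ ℓᵢ`. -/
theorem eq_of_forall_apply_l {v w : weylGroup r} (hvw : ∀ i, v.1 (l i) = w.1 (l i)) : v = w := by
  have hh : v.1 (h r) = w.1 (h r) := by
    have hK : v.1 (K r) = w.1 (K r) :=
      (weylGroup_preserves v.2).1.trans (weylGroup_preserves w.2).1.symm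
    simp only [K, map_add, map_smul, map_sum, hvw, add_left_inj] at hK
    exact smul_right_injective _ (by norm_num : (-3 : ℤ) ≠ 0) hK
  refine Subtype.ext (LinearEquiv.ext fun x => ?_)
  have hx : x = x.1 • h r + ∑ i, x.2 i • l i := by
    refine Prod.ext ?_ (funext fun j => ?_)
    · simp [h, l, Prod.fst_sum]
    · simp [h, l, Prod.snd_sum, Finset.sum_apply, Pi.single_apply]
  rw [hx]
  simp only [map_add, map_smul, map_sum, hvw, hh]

/-- The exceptional divisor classes are lines. -/
def exceptionalLine (i : Fin r) : Line r := ⟨l i, by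
  have hK : ∀ j, (K r).2 j = 1 := by
    intro j; simp [K, h, l, Prod.snd_sum, Finset.sum_apply, Pi.single_apply]
  simp [pairing_apply, l, hK, Pi.single_apply]⟩

theorem eq_of_forall_smul_line {v w : weylGroup r}
    (hvw : ∀ i : Fin r, v • exceptionalLine i = w • exceptionalLine i) : v = w :=
  eq_of_forall_apply_l fun i => congrArg Subtype.val (hvw i)

theorem finite_weylGroup (h8 : r ≤ 8) : Finite (weylGroup r) := by
  have := finite_line h8
  exact Finite.of_injective (fun w (x : Line r) => w • x) fun v w hvw =>
    eq_of_forall_smul_line fun i => congrFun hvw _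

/-- The signature as a complex character. -/
noncomputable def signChar (r : ℕ) : weylGroup r →* ℂ :=
  (Int.castRingHom ℂ : ℤ →* ℂ).comp ((Units.coeHom ℤ).comp (sign r))

theorem signChar_apply (w : weylGroup r) : signChar r w = ((sign r w : ℤ) : ℂ) := rfl

open Representation

/-- The vanishing of the twisted sum modulo a subspace `S` is a property to which the search
applies. -/
theorem isReflectionTrivial_twistedSum [Fintype (weylGroup r)] (n : ℕ)
    (S : Submodule ℂ (⋀[ℂ]^n (MonoidAlgebra ℂ (Line r)))) :
    IsReflectionTrivial fun t => twistedSum (signChar r) n t ∈ S where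
  perm {s t} hst hs := by
    rcases (twistedSum_swapNeg (signChar r) n).perm hst with h | h
    · rwa [← h]
    · rw [h] at hs; exact (Submodule.neg_mem_iff S).1 hs
  smul w {t} ht := by
    rw [twistedSum_map_smul] at ht
    refine (Submodule.smul_mem_iff S ?_).1 ht
    rw [signChar_apply]
    exact_mod_cast (sign r w).ne_zero
  of_orthogonal ρ {t} hρ ht := by
    rw [twistedSum_eq_zero (g := ⟨reflection ρ, hρ.1⟩)]
    · exact zero_mem S
    · rw [signChar_apply, sign_reflection]; simp
    · intro x hx
      refine Subtype.ext ?_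
      change reflection ρ x.1 = x.1
      rw [reflection_apply, ht x hx, zero_smul, add_zero]

namespace Code

/-- The search from the start: `p` is empty, and all lines form one block. -/
theorem of_survivors (h4 : 4 ≤ r) (h8 : r ≤ 8) {Z : List (Line r) → Prop}
    (hZ : IsReflectionTrivial Z)
    (hs : ∀ t : List (Line r), t.map (fun x => code x.1) ∈ survivors r → Z t)
    {q : List (Line r)} (hq : q.length = r - 2) : Z q := by
  have := finite_line h8
  obtain ⟨c, hk, hc⟩ := exists_table h4 h8
  have hb := bounded_eq_true h4 h8
  simp only [bounded, Bool.and_eq_true, List.all_eq_true] at hb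
  obtain ⟨Φ, hΦ, hΦ'⟩ := hc.rootMasks_eq (l := roots r) fun d hd =>
    ⟨hb.1.2 d hd, exists_of_mem_roots h4 h8 hd⟩
  simp only [survivors, hk, hΦ] at hs
  have h := hc.of_search hZ (r - 3) [] Φ [mask c.ones] hΦ' (fun B hB w _ x => ?_) hs q (by omega)
    fun x _ => ⟨_, List.mem_singleton_self _, hc.testBit_ones x⟩
  · simpa using h
  · rw [List.mem_singleton.1 hB, hc.testBit_ones, hc.testBit_ones]

/-- Words act as elements of the Weyl group, with determinant given by the parity of their length.
-/
theorem exists_of_applyWord (h4 : 4 ≤ r) (h8 : r ≤ 8) (w : List ℕ) :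
    ∃ g : weylGroup r, sign r g = (-1) ^ (select (roots r) w).length ∧ ∀ t : List (Line r),
      applyWord (select (roots r) w) (t.map fun x => code x.1) =
        (t.map (g • ·)).map fun x => code x.1 := by
  have hw : ∀ ρ ∈ select (roots r) w, ρ ∈ roots r := by
    intro ρ hρ
    obtain ⟨i, -, hi⟩ := List.mem_filterMap.1 hρ
    exact List.mem_of_getElem? hi
  generalize select (roots r) w = ρs at hw
  induction ρs with
  | nil => exact ⟨1, by simp, fun t => by simp [applyWord]⟩
  | cons d ρs ih =>
    obtain ⟨ρ, rfl, hρ⟩ := exists_of_mem_roots h4 h8 (hw _ List.mem_cons_self)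
    obtain ⟨g, hg, hg'⟩ := ih fun e he => hw e (List.mem_cons_of_mem _ he)
    refine ⟨g * ⟨reflection ρ, hρ.1⟩, ?_, fun t => ?_⟩
    · rw [map_mul, hg, sign_reflection, List.length_cons, pow_succ]
    · rw [applyWord, forceCodes_eq]
      have := hg' (t.map ((⟨reflection ρ, hρ.1⟩ : weylGroup r) • ·))
      simp only [List.map_map, Function.comp_def, mul_smul] at this ⊢
      rw [← this]
      congr 1
      refine List.map_congr_left fun x _ => ?_
      rw [reflect_code, ← reflection_apply]
      rfl

/-! ### Correctness of the certificates -/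

theorem code_val_injective : Function.Injective fun x : Line r => code x.1 :=
  code_injective.comp Subtype.val_injective

theorem exists_line {s : List Code} (hs : ∀ c ∈ s, isLine r c) :
    ∃ t : List (Line r), t.map (fun x => code x.1) = s := by
  induction s with
  | nil => exact ⟨[], rfl⟩
  | cons c s ih =>
    obtain ⟨t, ht⟩ := ih fun d hd => hs d (List.mem_cons_of_mem _ hd)
    have hc := hs c List.mem_cons_self
    simp only [isLine, Bool.and_eq_true, decide_eq_true_eq] at hc
    obtain ⟨x, rfl⟩ := exists_code_eq hc.1.1
    rw [pair_code, pair_code] at hc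
    exact ⟨⟨x, hc.1.2, hc.2⟩ :: t, by simp [ht]⟩

/-- A certified twisted sum lies in every subspace `S` that contains the twisted sums of the
representatives. -/
theorem of_certify [Fintype (weylGroup r)] (h4 : 4 ≤ r) (h8 : r ≤ 8) {n : ℕ}
    {S : Submodule ℂ (⋀[ℂ]^n (MonoidAlgebra ℂ (Line r)))}
    (hlines : ∀ s ∈ representatives, ∀ c ∈ s, isLine r c)
    (hS : ∀ t : List (Line r), t.map (fun x => code x.1) ∈ representatives →
      twistedSum (signChar r) n t ∈ S)
    {t : List (Line r)} {k : ℕ × List ℕ}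
    (hk : certify (roots r) (t.map fun x => code x.1) k = true) :
    twistedSum (signChar r) n t ∈ S := by
  obtain ⟨k, w⟩ := k
  obtain ⟨g, hg, hgt⟩ := exists_of_applyWord h4 h8 w
  have hF := twistedSum_map_smul (signChar r) n g t
  have hswap := twistedSum_swapNeg (signChar r) n (X := Line r)
  have hχ : signChar r g ≠ 0 := by
    rw [signChar_apply]
    exact_mod_cast (sign r g).ne_zero
  cases k with
  | zero =>
    simp only [certify, forceCodes_eq, hgt, Bool.and_eq_true, decide_eq_true_eq,
      List.permSign_map code_val_injective] at hk
    rw [hswap.eq_permSign_smul hk.1, ← Int.cast_smul_eq_zsmul ℂ, ← sub_eq_zero, ← sub_smul,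
      smul_eq_zero] at hF
    -- `w` multiplies the twisted sum both by its determinant and by the other sign
    rcases hF with hF | hF
    · refine absurd ?_ hk.2
      rw [sub_eq_zero, signChar_apply, hg] at hF
      have : ((((t.map (g • ·)).permSign t : ℤ)) : ℂ) =
          (((-1) ^ (select (roots r) w).length : ℤ) : ℂ) := by rw [hF]; simp
      exact_mod_cast this
    · rw [hF]; exact zero_mem S
  | succ k =>
    simp only [certify, forceCodes_eq, hgt] at hk
    split at hk
    · simp at hk
    · rename_i s hs
      have hs := List.mem_of_getElem? hs
      obtain ⟨t', rfl⟩ := exists_line (hlines s hs)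
      simp only [decide_eq_true_eq, List.permSign_map code_val_injective] at hk
      rw [hswap.eq_permSign_smul hk] at hF
      have := zsmul_mem (hS t' hs) ((t.map (g • ·)).permSign t')
      rw [hF] at this
      exact (Submodule.smul_mem_iff S hχ).1 this

theorem exists_certify_of_certifyAll {R : List Code} {ts : List (List Code)}
    {ks : List (ℕ × List ℕ)} (h : certifyAll R ts ks = true) {t : List Code} (ht : t ∈ ts) :
    ∃ k, certify R t k = true := by
  induction ts generalizing ks with
  | nil => simp at ht
  | cons s ts ih =>
    cases ks with
    | nil => simp [certifyAll] at h
    | cons k ks =>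
      simp only [certifyAll, forceCodes_eq, Bool.and_eq_true] at h
      rcases List.mem_cons.1 ht with rfl | ht
      · exact ⟨k, h.1⟩
      · exact ih h.2 ht

/-- The list `isometries t u []` contains all images of `t` in `u` under the Weyl group. -/
theorem map_mem_isometries (g : weylGroup r) {t u : List (Line r)} (h : ∀ x ∈ t, g • x ∈ u)
    {A : List (Code × Code)}
    (hA : ∀ z ∈ A, ∃ x : Line r, z = (code x.1, code (g • x).1)) :
    (t.map (g • ·)).map (fun x => code x.1) ∈
      isometries (t.map fun x => code x.1) (u.map fun x => code x.1) A := by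
  induction t generalizing A with
  | nil => simp [isometries]
  | cons x t ih =>
    simp only [List.map_cons, isometries, List.mem_flatMap]
    refine ⟨code (g • x).1, List.mem_map.2 ⟨_, h x List.mem_cons_self, rfl⟩, ?_⟩
    rw [if_pos]
    · refine List.mem_map.2 ⟨_, ih (fun y hy => h y (List.mem_cons_of_mem _ hy)) ?_, rfl⟩
      intro z hz
      rcases List.mem_cons.1 hz with rfl | hz
      · exact ⟨x, rfl⟩
      · exact hA z hz
    · rw [List.all_eq_true]
      intro z hz
      obtain ⟨y, rfl⟩ := hA z hz
      rw [decide_eq_true_eq, pair_code, pair_code, coe_smul_line, coe_smul_line,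
        (weylGroup_preserves g.2).2]

theorem exists_word_of_realize {R t : List Code} {us : List (List Code)} {ws : List (List ℕ)}
    (h : realize R t us ws = true) {u : List Code} (hu : u ∈ us) :
    ∃ w, applyWord (select R w) t = u ∧ u.permSign t = (-1) ^ (select R w).length := by
  induction us generalizing ws with
  | nil => simp at hu
  | cons v us ih =>
    cases ws with
    | nil => simp [realize] at h
    | cons w ws =>
      simp only [realize, Bool.and_eq_true, decide_eq_true_eq] at h
      rcases List.mem_cons.1 hu with rfl | hu
      · exact ⟨w, h.1⟩
      · exact ih h.2 hu

/-- The blocks are stable under the pointwise stabilizer of `t`, which therefore fixes a line that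
is alone in its block. -/
theorem Table.Valid.smul_eq_of_isolated {c : Table} (hc : c.Valid r) {t : List (Line r)}
    {x : Line r} (h : c.isolated (t.map fun y => code y.1) (code x.1) = true) {g : weylGroup r}
    (hg : ∀ y ∈ t, g • y = y) : g • x = x := by
  have key : (∀ B ∈ (t.map fun y => code y.1).foldr c.refine [mask c.ones], c.Stable t B) ∧
      ∃ B ∈ (t.map fun y => code y.1).foldr c.refine [mask c.ones], B.testBit (c.pos x) := by
    clear h hg
    induction t with
    | nil =>
      refine ⟨fun B hB w _ y => ?_, _, List.mem_singleton_self _, hc.testBit_ones x⟩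
      rw [List.mem_singleton.1 hB, hc.testBit_ones, hc.testBit_ones]
    | cons y t ih =>
      obtain ⟨h1, B, hB, hxB⟩ := ih
      exact ⟨hc.stable_of_mem_refine y h1, c.exists_mem_refine _ hB hxB⟩
  obtain ⟨hst, B, hB, hxB⟩ := key
  simp only [isolated, force_eq, List.all_eq_true] at h
  have hbits := h B hB
  rw [show 9 * c.lines.idxOf (code x.1) + 64 = c.pos x from rfl,
    List.elem_eq_true_of_mem (hc.mem_bits hxB), Bool.not_true, Bool.false_or,
    decide_eq_true_eq] at hbits
  have hgx : c.pos (g • x) ∈ bits B := hc.mem_bits (by rwa [hst B hB g hg])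
  rw [hbits, List.mem_singleton] at hgx
  have := congrArg c.lineAt hgx
  rw [hc.lineAt_pos, hc.lineAt_pos] at this
  exact code_val_injective this

/-! ### The finite verifications -/

set_option maxRecDepth 100000

theorem survivors_eq_nil (h4 : 4 ≤ r) (h7 : r ≤ 7) : survivors r = [] := by
  interval_cases r <;> decide +kernel

theorem certifyAll_survivors :
    (forceCodes (roots 8) fun R => certifyAll R (survivors 8) certificates) = true := by
  decide +kernel

theorem isLine_representatives :
    ∀ s ∈ representatives, s.length = 6 ∧ s.Nodup ∧ ∀ c ∈ s, isLine 8 c := by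
  decide +kernel

theorem isometries_eq_nil :
    ∀ s ∈ representatives, ∀ t ∈ representatives, s ≠ t → isometries s t [] = [] := by
  decide +kernel

theorem realize_isometries : (forceCodes (roots 8) fun R =>
    (List.finRange representatives.length).all fun i => realize R (representatives.get i)
      (isometries (representatives.get i) (representatives.get i) [])
      (stabilizers.getD i [])) = true := by
  decide +kernel

theorem isolated_l : (withTable 8 fun c => representatives.all fun t =>
    (List.finRange 8).all fun i => forceCode (code (l i)) (c.isolated t)) = true := by
  decide +kernel

end Code

/-! ### The dimension of the sign eigenspace -/

theorem finrank_eigenspace_of_le_seven (h4 : 4 ≤ r) (h7 : r ≤ 7) :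
    Module.finrank ℂ (eigenspace ((lineRep r).exteriorPow (r - 2)) (signChar r)) = 0 := by
  have := finite_weylGroup (r := r) (by omega)
  have := Fintype.ofFinite (weylGroup r)
  suffices h : eigenspace ((lineRep r).exteriorPow (r - 2)) (signChar r) = ⊥ by
    rw [h, finrank_bot]
  rw [eigenspace_exteriorPow_ofMulAction, Submodule.span_eq_bot]
  rintro _ ⟨t, rfl⟩
  by_cases ht : t.length = r - 2
  · rw [← Submodule.mem_bot ℂ]
    refine Code.of_survivors h4 (by omega) (isReflectionTrivial_twistedSum _ _) ?_ ht
    rw [Code.survivors_eq_nil h4 h7]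
    simp
  · exact twistedSum_of_length_ne _ ht

theorem finrank_eigenspace_eight :
    Module.finrank ℂ (eigenspace ((lineRep 8).exteriorPow 6) (signChar 8)) = 5 := by
  have := finite_line (r := 8) le_rfl
  have := finite_weylGroup (r := 8) le_rfl
  have := Fintype.ofFinite (weylGroup 8)
  have hrep := Code.isLine_representatives
  choose T hT using fun i : Fin Code.representatives.length =>
    Code.exists_line (hrep _ (List.get_mem _ i)).2.2
  have hTlen (i) : (T i).length = 6 := by
    rw [← (hrep _ (List.get_mem Code.representatives i)).1, ← hT i, List.length_map]
  have hTnodup (i) : (T i).Nodup :=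
    List.Nodup.of_map (fun x => code x.1) (by rw [hT]; exact (hrep _ (List.get_mem _ i)).2.1)
  have hmemT {t : List (Line 8)} (ht : t.map (fun x => code x.1) ∈ Code.representatives) :
      ∃ i, T i = t := by
    obtain ⟨i, hi⟩ := List.get_of_mem ht
    exact ⟨i, Code.code_val_injective.list_map (by rw [hT, hi])⟩
  have hspan : eigenspace ((lineRep 8).exteriorPow 6) (signChar 8) =
      Submodule.span ℂ (Set.range fun i => twistedSum (signChar 8) 6 (T i)) := by
    rw [eigenspace_exteriorPow_ofMulAction]
    refine le_antisymm (Submodule.span_le.2 ?_) (Submodule.span_mono ?_)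
    · rintro _ ⟨t, rfl⟩
      by_cases ht : t.length = 6
      · refine Code.of_survivors (by norm_num) le_rfl (isReflectionTrivial_twistedSum _ _)
          (fun s hs => ?_) ht
        have hcert := Code.certifyAll_survivors
        rw [Code.forceCodes_eq] at hcert
        obtain ⟨k, hk⟩ := Code.exists_certify_of_certifyAll hcert hs
        refine Code.of_certify (by norm_num) le_rfl (fun s hs => (hrep s hs).2.2)
          (fun u hu => ?_) hk
        obtain ⟨i, rfl⟩ := hmemT hu
        exact Submodule.subset_span ⟨i, rfl⟩
      · rw [twistedSum_of_length_ne _ ht]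
        exact zero_mem _
    · rintro _ ⟨i, rfl⟩
      exact ⟨T i, rfl⟩
  have hind : LinearIndependent ℂ fun i => twistedSum (signChar 8) 6 (T i) := by
    refine linearIndependent_twistedSum (signChar 8) hTlen hTnodup (fun i j g hg => ?_)
      fun i g hg => ?_
    · by_contra hij
      have hmem := Code.map_mem_isometries g hg (A := []) (by simp)
      rw [hT, hT, Code.isometries_eq_nil _ (List.get_mem _ _) _ (List.get_mem _ _)] at hmem
      · simp at hmem
      · intro h
        have : Code.representatives.Nodup := by decide +kernel
        exact hij (this.injective_get h).symm
    · have hmem := Code.map_mem_isometries g hg (A := []) (by simp)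
      have hreal := Code.realize_isometries
      rw [Code.forceCodes_eq, List.all_eq_true] at hreal
      obtain ⟨w, hw, hsgn⟩ := Code.exists_word_of_realize (hreal i (List.mem_finRange i))
        (by rw [← hT i]; exact hmem)
      obtain ⟨v, hv, hvt⟩ := Code.exists_of_applyWord (r := 8) (by norm_num) le_rfl w
      rw [← hT i, hvt] at hw
      rw [← hT i, List.permSign_map Code.code_val_injective] at hsgn
      have hvg : (T i).map (v • ·) = (T i).map (g • ·) := Code.code_val_injective.list_map hw
      -- `v⁻¹ g` fixes the representative, hence every exceptional class
      have hfix : ∀ x ∈ T i, (v⁻¹ * g) • x = x := fun x hx => by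
        rw [mul_smul, ← List.map_inj_left.1 hvg x hx, inv_smul_smul]
      obtain ⟨c, hk, hc⟩ := Code.exists_table (r := 8) (by norm_num) le_rfl
      have hiso := Code.isolated_l
      simp only [hk, List.all_eq_true, Code.forceCode_eq] at hiso
      have hvg' : v⁻¹ * g = 1 := eq_of_forall_smul_line fun j => by
        rw [one_smul]
        refine hc.smul_eq_of_isolated (t := T i) ?_ hfix
        rw [hT]
        exact hiso _ (List.get_mem _ i) j (List.mem_finRange j)
      obtain rfl : v = g := inv_mul_eq_one.1 hvg'
      refine ⟨_, hsgn, pow_ne_zero _ (by norm_num), ?_⟩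
      rw [signChar_apply, hv]
      simp
  rw [hspan, finrank_span_eq_card hind]
  rfl

end Pic

theorem mainTheorem4 (r : ℕ) (hr : 4 ≤ r) (hr' : r ≤ 8) :
    ((Pic.lineRep r).exteriorPow (r - 2)).HasMultiplicity (Pic.signRep r)
      (if r = 8 then 5 else 0) := by
  have := Pic.finite_line hr'
  have := Pic.finite_weylGroup hr'
  have : FiniteDimensional ℂ (MonoidAlgebra ℂ (Pic.Line r)) :=
    Module.Finite.equiv (MonoidAlgebra.coeffLinearEquiv ℂ).symm
  refine Representation.hasMultiplicity_of_finrank_eigenspace _ _ (Pic.signChar r)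
    (fun g x => rfl) ?_
  split_ifs with h8
  · subst h8
    exact Pic.finrank_eigenspace_eight
  · exact Pic.finrank_eigenspace_of_le_seven hr (by omega)
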